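/- A groupoid is a set with one binary operation, written as multiplication. The clone of a groupoid $\mathbb A$ on a set $A$ is the set of all its term operations; it is minimal if it is an atom in the lattice of all clones on $A$, i.e. if it contains an operation that is not a projection and its only proper subclone is the clone of all projections. An SH-groupoid (Szász–Hájek groupoid) is a groupoid with exactly one nonassociative triple, i.e. exactly one triple $(a,b,c)$ with $(ab)c\neq a(bc)$; it is minimal if it is generated by $\{a,b,c\}$. Groupoids $\mathbb A$ and $\mathbb B$ are dually isomorphic if $\mathbb A$ is isomorphic to the dual of $\mathbb B$ (the groupoid on the same set with multiplication $x * y = yx$). Theorem 3.4. Every minimal SH-groupoid (on a set of any cardinality) that has a minimal clone is isomorphic or dually isomorphic to one of the following ten groupoids $\mathbb G_1,\dots,\mathbb G_{10}$. Conversely, each of these ten groupoids is a minimal SH-groupoid with a minimal clone. Moreover, up to isomorphism, $\mathbb G_2$ is a factor groupoid of $\mathbb G_1$; $\mathbb G_5$ is a factor groupoid of $\mathbb G_4$; and $\mathbb G_7,\mathbb G_8,\mathbb G_9,\mathbb G_{10}$ are factor groupoids of $\mathbb G_6$. The entry in row $x$ and column $y$ of each table is the product $xy$: $$\mathbb G_{1}:\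 \begin{array}{c|ccccc}\cdot&a&b&c&e&f\\\hline a&a&a&c&f&f\\ b&b&b&e&e&e\\ c&c&c&c&c&c\\ e&e&e&e&e&e\\ f&f&f&f&f&f\end{array}$$ $$\mathbb G_{2}:\ \begin{array}{c|cccc}\cdot&a&b&c&e\\\hline a&a&a&c&e\\ b&b&b&e&e\\ c&c&c&c&c\\ e&e&e&e&e\end{array}$$ $$\mathbb G_{3}:\ \begin{array}{c|ccc}\cdot&a&b&c\\\hline a&a&a&c\\ b&b&b&b\\ c&c&c&c\end{array}$$ $$\mathbb G_{4}:\ \begin{array}{c|cccccc}\cdot&a&b&c&e&f&g\\\hline a&a&a&g&f&f&g\\ b&a&b&e&e&f&g\\ c&c&c&c&c&c&c\\ e&e&e&e&e&e&e\\ f&f&f&f&f&f&f\\ g&g&g&g&g&g&g\end{array}$$ $$\mathbb G_{5}:\ \begin{array}{c|ccccc}\cdot&a&b&c&e&g\\\hline a&a&a&g&e&g\\ b&a&b&e&e&g\\ c&c&c&c&c&c\\ e&e&e&e&e&e\\ g&g&g&g&g&g\end{array}$$ $$\mathbb G_{6}:\ \begin{array}{c|cccccccc}\cdot&a&b&c&d&f&g&h&i\\\hline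 a&a&d&f&d&f&g&d&g\\ b&h&b&c&h&i&i&h&i\\ c&c&c&c&c&c&c&c&c\\ d&d&d&g&d&g&g&d&g\\ f&f&f&f&f&f&f&f&f\\ g&g&g&g&g&g&g&g&g\\ h&h&h&i&h&i&i&h&i\\ i&i&i&i&i&i&i&i&i\end{array}$$ $$\mathbb G_{7}:\ \begin{array}{c|ccccccc}\cdot&a&b&c&d&f&g&h\\\hline a&a&d&f&d&f&g&d\\ b&h&b&c&h&g&g&h\\ c&c&c&c&c&c&c&c\\ d&d&d&g&d&g&g&d\\ f&f&f&f&f&f&f&f\\ g&g&g&g&g&g&g&g\\ h&h&h&g&h&g&g&h\end{array}$$ $$\mathbb G_{8}:\ \begin{array}{c|cccccc}\cdot&a&b&c&d&f&g\\\hline a&a&d&f&d&f&g\\ b&d&b&c&d&g&g\\ c&c&c&c&c&c&c\\ d&d&d&g&d&g&g\\ f&f&f&f&f&f&f\\ g&g&g&g&g&g&g\end{array}$$ $$\mathbb G_{9}:\ \begin{array}{c|cccccc}\cdot&a&b&c&d&f&h\\\hline a&a&d&f&d&f&d\\ b&h&b&c&h&h&h\\ c&c&c&c&c&c&c\\ d&d&d&d&d&d&d\\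 f&f&f&f&f&f&f\\ h&h&h&h&h&h&h\end{array}$$ $$\mathbb G_{10}:\ \begin{array}{c|ccccc}\cdot&a&b&c&d&f\\\hline a&a&d&f&d&f\\ b&d&b&c&d&d\\ c&c&c&c&c&c\\ d&d&d&d&d&d\\ f&f&f&f&f&f\end{array}$$ -/

import Mathlib

/-! Throughout, a groupoid is a type with one binary operation, that is, a type `A` with `[Mul A]`;
no law is assumed. -/

namespace SzaszHajek

universe u v

/-! ### Clones -/

/-- A clone on `A`: a set of finitary operations on `A` (`ops n` is its `n`-ary part) that contains
all projections and is closed under composition. -/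
@[ext]
structure OpClone (A : Type u) where
  /-- The `n`-ary operations of the clone. -/
  ops : ∀ n : ℕ, Set ((Fin n → A) → A)
  proj_mem : ∀ (n : ℕ) (i : Fin n), (fun x : Fin n → A => x i) ∈ ops n
  comp_mem : ∀ (m n : ℕ) (f : (Fin m → A) → A) (g : Fin m → (Fin n → A) → A),
    f ∈ ops m → (∀ i, g i ∈ ops n) → (fun x : Fin n → A => f (fun i => g i x)) ∈ ops n

/-- Clones are ordered by inclusion. -/
instance (A : Type u) : PartialOrder (OpClone A) where
  le C D := ∀ n, C.ops n ⊆ D.ops n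
  le_refl _ _ := subset_rfl
  le_trans _ _ _ h₁ h₂ n := (h₁ n).trans (h₂ n)
  le_antisymm _ _ h₁ h₂ := OpClone.ext (funext fun n => (h₁ n).antisymm (h₂ n))

/-- The least clone is the trivial clone, which consists of the projections. -/
instance (A : Type u) : OrderBot (OpClone A) where
  bot :=
    { ops := fun n => {f | ∃ i : Fin n, f = fun x => x i}
      proj_mem := fun _ i => ⟨i, rfl⟩
      comp_mem := by
        rintro m n f g ⟨i, rfl⟩ hg
        exact hg i }
  bot_le C n := by
    rintro f ⟨i, rfl⟩
    exact C.proj_mem n i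

/-- The `n`-ary term function of the groupoid `A` induced by a groupoid term `t` in `n` variables;
such a term is an element of the absolutely free groupoid `FreeMagma (Fin n)`. -/
def termFun (A : Type u) [Mul A] {n : ℕ} (t : FreeMagma (Fin n)) : (Fin n → A) → A :=
  fun x => FreeMagma.lift x t

/-- The clone of a groupoid: the clone of all its term functions. -/
def clo (A : Type u) [Mul A] : OpClone A where
  ops n := Set.range (termFun A (n := n))
  proj_mem _ i := ⟨FreeMagma.of i, rfl⟩
  comp_mem := by
    rintro m n _ g ⟨t, rfl⟩ hg
    choose s hs using hg
    refine ⟨FreeMagma.lift s t, funext fun x => ?_⟩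
    induction t with
    | ih1 i => exact congrFun (hs i) x
    | ih2 p q hp hq =>
      simp only [termFun, map_mul] at hp hq ⊢
      rw [hp, hq]

/-- A groupoid has a minimal clone if its clone is an atom in the lattice of all clones on its
underlying set: it is not trivial, and its only proper subclone is the trivial one. -/
def HasMinimalClone (A : Type u) [Mul A] : Prop :=
  IsAtom (clo A)

/-! ### Szász–Hájek groupoids -/

/-- The set of nonassociative triples of a groupoid. -/
def nonassocTriples (A : Type u) [Mul A] : Set (A × A × A) :=
  {t | (t.1 * t.2.1) * t.2.2 ≠ t.1 * (t.2.1 * t.2.2)}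

/-- A Szász–Hájek groupoid (SH-groupoid) is a groupoid with exactly one nonassociative triple. -/
def IsSH (A : Type u) [Mul A] : Prop :=
  (nonassocTriples A).encard = 1

/-- A minimal SH-groupoid is an SH-groupoid that is generated by (the components of) its
nonassociative triple. Mathlib's `Subsemigroup` of a type with a multiplication is just a subset
closed under multiplication, that is, a subgroupoid. -/
def IsMinimalSH (A : Type u) [Mul A] : Prop :=
  IsSH A ∧ ∀ a b c : A, (a, b, c) ∈ nonassocTriples A →
    Subsemigroup.closure ({a, b, c} : Set A) = ⊤

/-- `A` is isomorphic or dually isomorphic to `B`. Here `Bᵐᵒᵖ` is the dual of `B`. -/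
def IsoOrDuallyIso (A : Type u) (B : Type v) [Mul A] [Mul B] : Prop :=
  Nonempty (A ≃* B) ∨ Nonempty (A ≃* Bᵐᵒᵖ)

/-- `B` is (isomorphic to) a factor groupoid of `A`. -/
def IsFactorOf (B : Type v) (A : Type u) [Mul B] [Mul A] : Prop :=
  ∃ r : Con A, Nonempty (r.Quotient ≃* B)

/-! ### The ten groupoids -/

/-- The groupoid on `{0, …, n - 1}` with multiplication table `t`; the entry in row `x` and column
`y` is the product `x * y`. -/
def TableGroupoid {n : ℕ} (_t : Fin n → Fin n → Fin n) : Type :=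
  Fin n

instance {n : ℕ} (t : Fin n → Fin n → Fin n) : Mul (TableGroupoid t) where
  mul := t

instance {n : ℕ} (t : Fin n → Fin n → Fin n) : Fintype (TableGroupoid t) :=
  inferInstanceAs (Fintype (Fin n))

instance {n : ℕ} (t : Fin n → Fin n → Fin n) : DecidableEq (TableGroupoid t) :=
  inferInstanceAs (DecidableEq (Fin n))

/-- The multiplication table of `G1`, with rows and columns in the order `a b c e f`. -/
def tableG1 : Fin 5 → Fin 5 → Fin 5 :=
  let a : Fin 5 := 0; let b : Fin 5 := 1; let c : Fin 5 := 2; let e : Fin 5 := 3; let f : Fin 5 := 4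
  ![![a, a, c, f, f],
    ![b, b, e, e, e],
    ![c, c, c, c, c],
    ![e, e, e, e, e],
    ![f, f, f, f, f]]

/-- The groupoid `G1`. -/
abbrev G1 : Type := TableGroupoid tableG1

/-- The multiplication table of `G2`, with rows and columns in the order `a b c e`. -/
def tableG2 : Fin 4 → Fin 4 → Fin 4 :=
  let a : Fin 4 := 0; let b : Fin 4 := 1; let c : Fin 4 := 2; let e : Fin 4 := 3
  ![![a, a, c, e],
    ![b, b, e, e],
    ![c, c, c, c],
    ![e, e, e, e]]

/-- The groupoid `G2`. -/
abbrev G2 : Type := TableGroupoid tableG2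

/-- The multiplication table of `G3`, with rows and columns in the order `a b c`. -/
def tableG3 : Fin 3 → Fin 3 → Fin 3 :=
  let a : Fin 3 := 0; let b : Fin 3 := 1; let c : Fin 3 := 2
  ![![a, a, c],
    ![b, b, b],
    ![c, c, c]]

/-- The groupoid `G3`. -/
abbrev G3 : Type := TableGroupoid tableG3

/-- The multiplication table of `G4`, with rows and columns in the order `a b c e f g`. -/
def tableG4 : Fin 6 → Fin 6 → Fin 6 :=
  let a : Fin 6 := 0; let b : Fin 6 := 1; let c : Fin 6 := 2; let e : Fin 6 := 3
  let f : Fin 6 := 4; let g : Fin 6 := 5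
  ![![a, a, g, f, f, g],
    ![a, b, e, e, f, g],
    ![c, c, c, c, c, c],
    ![e, e, e, e, e, e],
    ![f, f, f, f, f, f],
    ![g, g, g, g, g, g]]

/-- The groupoid `G4`. -/
abbrev G4 : Type := TableGroupoid tableG4

/-- The multiplication table of `G5`, with rows and columns in the order `a b c e g`. -/
def tableG5 : Fin 5 → Fin 5 → Fin 5 :=
  let a : Fin 5 := 0; let b : Fin 5 := 1; let c : Fin 5 := 2; let e : Fin 5 := 3; let g : Fin 5 := 4
  ![![a, a, g, e, g],
    ![a, b, e, e, g],
    ![c, c, c, c, c],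
    ![e, e, e, e, e],
    ![g, g, g, g, g]]

/-- The groupoid `G5`. -/
abbrev G5 : Type := TableGroupoid tableG5

/-- The multiplication table of `G6`, with rows and columns in the order `a b c d f g h i`. -/
def tableG6 : Fin 8 → Fin 8 → Fin 8 :=
  let a : Fin 8 := 0; let b : Fin 8 := 1; let c : Fin 8 := 2; let d : Fin 8 := 3
  let f : Fin 8 := 4; let g : Fin 8 := 5; let h : Fin 8 := 6; let i : Fin 8 := 7
  ![![a, d, f, d, f, g, d, g],
    ![h, b, c, h, i, i, h, i],
    ![c, c, c, c, c, c, c, c],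
    ![d, d, g, d, g, g, d, g],
    ![f, f, f, f, f, f, f, f],
    ![g, g, g, g, g, g, g, g],
    ![h, h, i, h, i, i, h, i],
    ![i, i, i, i, i, i, i, i]]

/-- The groupoid `G6`. -/
abbrev G6 : Type := TableGroupoid tableG6

/-- The multiplication table of `G7`, with rows and columns in the order `a b c d f g h`. -/
def tableG7 : Fin 7 → Fin 7 → Fin 7 :=
  let a : Fin 7 := 0; let b : Fin 7 := 1; let c : Fin 7 := 2; let d : Fin 7 := 3
  let f : Fin 7 := 4; let g : Fin 7 := 5; let h : Fin 7 := 6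
  ![![a, d, f, d, f, g, d],
    ![h, b, c, h, g, g, h],
    ![c, c, c, c, c, c, c],
    ![d, d, g, d, g, g, d],
    ![f, f, f, f, f, f, f],
    ![g, g, g, g, g, g, g],
    ![h, h, g, h, g, g, h]]

/-- The groupoid `G7`. -/
abbrev G7 : Type := TableGroupoid tableG7

/-- The multiplication table of `G8`, with rows and columns in the order `a b c d f g`. -/
def tableG8 : Fin 6 → Fin 6 → Fin 6 :=
  let a : Fin 6 := 0; let b : Fin 6 := 1; let c : Fin 6 := 2; let d : Fin 6 := 3
  let f : Fin 6 := 4; let g : Fin 6 := 5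
  ![![a, d, f, d, f, g],
    ![d, b, c, d, g, g],
    ![c, c, c, c, c, c],
    ![d, d, g, d, g, g],
    ![f, f, f, f, f, f],
    ![g, g, g, g, g, g]]

/-- The groupoid `G8`. -/
abbrev G8 : Type := TableGroupoid tableG8

/-- The multiplication table of `G9`, with rows and columns in the order `a b c d f h`. -/
def tableG9 : Fin 6 → Fin 6 → Fin 6 :=
  let a : Fin 6 := 0; let b : Fin 6 := 1; let c : Fin 6 := 2; let d : Fin 6 := 3
  let f : Fin 6 := 4; let h : Fin 6 := 5
  ![![a, d, f, d, f, d],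
    ![h, b, c, h, h, h],
    ![c, c, c, c, c, c],
    ![d, d, d, d, d, d],
    ![f, f, f, f, f, f],
    ![h, h, h, h, h, h]]

/-- The groupoid `G9`. -/
abbrev G9 : Type := TableGroupoid tableG9

/-- The multiplication table of `G10`, with rows and columns in the order `a b c d f`. -/
def tableG10 : Fin 5 → Fin 5 → Fin 5 :=
  let a : Fin 5 := 0; let b : Fin 5 := 1; let c : Fin 5 := 2; let d : Fin 5 := 3; let f : Fin 5 := 4
  ![![a, d, f, d, f],
    ![d, b, c, d, d],
    ![c, c, c, c, c],
    ![d, d, d, d, d],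
    ![f, f, f, f, f]]

/-- The groupoid `G10`. -/
abbrev G10 : Type := TableGroupoid tableG10

end SzaszHajek

open SzaszHajek

namespace SzaszHajek

universe u v

/-! ### Consequences of minimality of a clone -/

/-! In a minimal clone every nontrivial term operation generates the multiplication, so any clone,
or any property closed under one nontrivial term, that captures such an operation captures the
multiplication too (`HasMinimalClone.mul_mem`, `HasMinimalClone.binary`,
`HasMinimalClone.semiprojection`). Applied to the term xx this gives idempotence.

In an idempotent groupoid with a single nonassociative triple (a, b, c), each of a, b, c is
irreducible: a product equals it only if some factor does. Hence x and y generate a band unless they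
cover the triple. Coincidences among a, b, c are refuted with properties of binary functions that a
nontrivial term preserves, so all pairs generate bands. The term (xy)x then forces xyx = xy or its
mirror image, and duality leaves the left regular law xyx = xy.

Under this law c is a left zero. Replacing a component of the triple by another element with the
same products gives an associative triple, and this settles which of ab, ba, ac, bc can be
generators. At most eight elements remain, with few possible coincidences: these are the ten tables.

Conversely, the two-variable laws of left regular bands reduce every term operation to a projection
or, by identification of variables, to xy (`LeftRegularLaws.proj_or_mul`). The tables satisfy these
laws, and all other claims about them are finite checks. -/

/-- The clone of all operations that preserve the relation `R`. -/
def polClone {A : Type u} {I : Type v} (R : Set (I → A)) : OpClone A where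
  ops n := {f | ∀ F : Fin n → I → A, (∀ i, F i ∈ R) → (fun k => f fun i => F i k) ∈ R}
  proj_mem _ i _ hF := hF i
  comp_mem _ _ _ g hf hg F hF := hf (fun i k => g i fun j => F j k) fun i => hg i F hF

/-- The clone of all operations that depend on at most one of their variables. -/
def unaryClone (A : Type u) : OpClone A where
  ops n := {f | ∃ (i : Fin n) (g : A → A), f = fun x => g (x i)}
  proj_mem _ i := ⟨i, id, rfl⟩
  comp_mem := by
    rintro m n _ g ⟨i, u, rfl⟩ hg
    obtain ⟨j, w, hw⟩ := hg i
    exact ⟨j, u ∘ w, by simp [hw]⟩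

theorem mul_mem_clo (A : Type u) [Mul A] :
    (fun x : Fin 2 → A => x 0 * x 1) ∈ (clo A).ops 2 :=
  ⟨.of 0 * .of 1, rfl⟩

/-- A clone that contains a nontrivial term operation of a groupoid with a minimal clone contains
the multiplication. -/
theorem HasMinimalClone.mul_mem {A : Type u} [Mul A] (hA : HasMinimalClone A) (D : OpClone A)
    {n : ℕ} (t : FreeMagma (Fin n)) (ht : ∀ i, termFun A t ≠ fun x => x i)
    (hD : termFun A t ∈ D.ops n) : (fun x : Fin 2 → A => x 0 * x 1) ∈ D.ops 2 := by
  -- The intersection of `clo A` with `D` lies below an atom, so it is all of `clo A` or trivial.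
  let C : OpClone A :=
    { ops := fun n => (clo A).ops n ∩ D.ops n
      proj_mem := fun n i => ⟨(clo A).proj_mem n i, D.proj_mem n i⟩
      comp_mem := fun m n f g hf hg =>
        ⟨(clo A).comp_mem m n f g hf.1 fun i => (hg i).1,
          D.comp_mem m n f g hf.2 fun i => (hg i).2⟩ }
  have hC : C ≤ clo A := fun n f hf => hf.1
  rcases hC.eq_or_lt with h | h
  · have := mul_mem_clo A
    rw [← h] at this
    exact this.2
  · have hbot := hA.2 C h
    have : termFun A t ∈ C.ops n := ⟨⟨t, rfl⟩, hD⟩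
    rw [hbot] at this
    obtain ⟨i, hi⟩ := this
    exact absurd hi (ht i)

theorem HasMinimalClone.not_proj {A : Type u} [Mul A] (hA : HasMinimalClone A) :
    (¬ ∀ x y : A, x * y = x) ∧ ¬ ∀ x y : A, x * y = y := by
  have key : ∀ i : Fin 2, ¬ ∀ x : Fin 2 → A, x 0 * x 1 = x i := by
    intro i h
    refine hA.1 (le_antisymm ?_ bot_le)
    intro n f hf
    obtain ⟨t, rfl⟩ := hf
    induction t with
    | ih1 j => exact ⟨j, rfl⟩
    | ih2 p q hp hq =>
      obtain ⟨j, hj⟩ := hp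
      obtain ⟨k, hk⟩ := hq
      have e : termFun A (p * q) = fun x => termFun A p x * termFun A q x := by
        funext x; simp [termFun]
      have e' : ∀ x y : A, x * y = (![x, y] : Fin 2 → A) i := fun x y => h ![x, y]
      fin_cases i
      · exact ⟨j, by rw [e, hj]; funext x; exact e' _ _⟩
      · exact ⟨k, by rw [e, hk]; funext x; exact e' _ _⟩
  exact ⟨fun h => key 0 fun x => h _ _, fun h => key 1 fun x => h _ _⟩

/-- A set of binary functions that contains the projections and is closed under a nontrivial
binary term operation `m` contains the multiplication. -/
theorem HasMinimalClone.binary {A : Type u} [Mul A] (hA : HasMinimalClone A)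
    (t : FreeMagma (Fin 2)) (m : A → A → A) (hm : ∀ x y, termFun A t ![x, y] = m x y)
    (P : (A → A → A) → Prop) (h₀ : P fun x _ => x) (h₁ : P fun _ y => y)
    (hP : ∀ F G, P F → P G → P fun x y => m (F x y) (G x y)) :
    (∀ x y, m x y = x) ∨ (∀ x y, m x y = y) ∨ P fun x y => x * y := by
  have ht : ∀ x : Fin 2 → A, termFun A t x = m (x 0) (x 1) := fun x => by
    rw [← hm]; congr 1; funext i; fin_cases i <;> rfl
  by_cases htriv : ∃ i, termFun A t = fun x => x i
  · obtain ⟨i, hi⟩ := htriv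
    fin_cases i
    · exact .inl fun x y => by rw [← hm, hi]; rfl
    · exact .inr (.inl fun x y => by rw [← hm, hi]; rfl)
  · push Not at htriv
    right; right
    -- Binary functions are tuples indexed by `A × A`, and `P` is a relation on such tuples
    -- preserved by `m`. The multiplication preserves it as well, and is its own value at the two
    -- projections.
    have := hA.mul_mem (polClone {F : A × A → A | P fun x y => F (x, y)}) t htriv
      (fun F hF => by
        simp only [ht]
        exact hP _ _ (hF 0) (hF 1))
    exact this ![fun p => p.1, fun p => p.2]
      (by intro i; fin_cases i <;> [exact h₀; exact h₁])

/-- In a groupoid with a minimal clone a ternary term operation that turns into the first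
projection whenever two of its variables are identified is the first projection. -/
theorem HasMinimalClone.semiprojection {A : Type u} [Mul A] (hA : HasMinimalClone A)
    (t : FreeMagma (Fin 3)) (m : A → A → A → A) (hm : ∀ x y z, termFun A t ![x, y, z] = m x y z)
    (h₁ : ∀ x y, m x x y = x) (h₂ : ∀ x y, m x y x = x) (h₃ : ∀ x y, m x y y = x) (x y z : A) :
    m x y z = x := by
  have ht : ∀ x : Fin 3 → A, termFun A t x = m (x 0) (x 1) (x 2) := fun x => by
    rw [← hm]; congr 1; funext i; fin_cases i <;> rfl
  by_cases htriv : ∃ i, termFun A t = fun x => x i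
  · obtain ⟨i, hi⟩ := htriv
    have key : ∀ x y z, m x y z = (![x, y, z] : Fin 3 → A) i := fun x y z => by rw [← hm, hi]
    fin_cases i
    · exact key x y z
    · have e : ∀ u v : A, u = v := fun u v => (h₂ u v).symm.trans (key u v u)
      exact e _ _
    · have e : ∀ u v : A, u = v := fun u v => (h₁ u v).symm.trans (key u u v)
      exact e _ _
  · push Not at htriv
    -- Among three arguments taken from two projections two coincide, so `m` returns the first
    -- argument. Thus the set of the two projections is preserved, which would make the
    -- multiplication a projection.
    have := hA.mul_mem (polClone {F : A × A → A | (∀ p, F p = p.1) ∨ ∀ p, F p = p.2}) t htriv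
      (fun F hF => by
        simp only [ht]
        rcases hF 0 with e₀ | e₀ <;> rcases hF 1 with e₁ | e₁ <;> rcases hF 2 with e₂ | e₂ <;>
          simp [e₀, e₁, e₂, h₁, h₂, h₃])
    have h := this ![fun p => p.1, fun p => p.2]
      (by intro i; fin_cases i <;> simp)
    rcases h with h | h
    · exact absurd (fun u v => h (u, v)) hA.not_proj.1
    · exact absurd (fun u v => h (u, v)) hA.not_proj.2

/-! ### Duality -/

/-- An equivalence of sets induces an isomorphism of their lattices of clones. -/
def OpClone.mapEquiv {A : Type u} {B : Type v} (e : A ≃ B) : OpClone A ≃o OpClone B where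
  toFun C :=
    { ops := fun n => {f | (fun x => e.symm (f fun i => e (x i))) ∈ C.ops n}
      proj_mem := fun n i => by simpa using C.proj_mem n i
      comp_mem := fun m n f g hf hg => by
        simpa using C.comp_mem m n _ _ hf hg }
  invFun C :=
    { ops := fun n => {f | (fun x => e (f fun i => e.symm (x i))) ∈ C.ops n}
      proj_mem := fun n i => by simpa using C.proj_mem n i
      comp_mem := fun m n f g hf hg => by
        simpa using C.comp_mem m n _ _ hf hg }
  left_inv C := by ext; simp
  right_inv C := by ext; simp
  map_rel_iff' {C D} := by
    refine ⟨fun h n f hf => ?_, fun h n f hf => h n hf⟩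
    have := @h n (fun x => e (f fun i => e.symm (x i))) (by simpa using hf)
    simpa using this

theorem HasMinimalClone.op {A : Type u} [Mul A] (hA : HasMinimalClone A) :
    HasMinimalClone Aᵐᵒᵖ := by
  -- `s` is the mirror image of `t`; the two equations serve the two inclusions between the clones.
  have rev : ∀ {n : ℕ} (t : FreeMagma (Fin n)), ∃ s : FreeMagma (Fin n), ∀ x : Fin n → A,
      MulOpposite.op (termFun A s x) = termFun Aᵐᵒᵖ t (fun i => MulOpposite.op (x i)) ∧
      MulOpposite.op (termFun A t x) = termFun Aᵐᵒᵖ s (fun i => MulOpposite.op (x i)) := by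
    intro n t
    induction t with
    | ih1 i => exact ⟨.of i, fun x => ⟨rfl, rfl⟩⟩
    | ih2 p q hp hq =>
      obtain ⟨p', hp⟩ := hp
      obtain ⟨q', hq⟩ := hq
      refine ⟨q' * p', fun x => ?_⟩
      have := hp x
      have := hq x
      simp only [termFun, map_mul, MulOpposite.op_mul] at *
      simp [*]
  have h : OpClone.mapEquiv MulOpposite.opEquiv (clo A) = clo Aᵐᵒᵖ := by
    ext n f
    constructor
    · rintro ⟨t, ht⟩
      obtain ⟨s, hs⟩ := rev t
      refine ⟨s, funext fun x => ((hs fun i => (x i).unop).2).symm.trans ?_⟩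
      rw [ht]
      rfl
    · rintro ⟨t, rfl⟩
      obtain ⟨s, hs⟩ := rev t
      exact ⟨s, funext fun x => MulOpposite.op_injective (hs x).1⟩
  unfold HasMinimalClone
  rw [← h, OrderIso.isAtom_iff]
  exact hA

/-! ### Idempotent groupoids with one nonassociative triple -/

theorem mem_nonassocTriples {A : Type u} [Mul A] {a b c : A} :
    (a, b, c) ∈ nonassocTriples A ↔ a * b * c ≠ a * (b * c) :=
  Iff.rfl

/-- `(a, b, c)` is the only nonassociative triple of the idempotent groupoid `A`, and it
generates `A`. -/
structure IdemSH {A : Type u} [Mul A] (a b c : A) : Prop where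
  idem : ∀ x : A, x * x = x
  ne : a * b * c ≠ a * (b * c)
  assoc_or : ∀ x y z : A, x * y * z = x * (y * z) ∨ x = a ∧ y = b ∧ z = c
  gen : Subsemigroup.closure ({a, b, c} : Set A) = ⊤

/-- If xx is not the identity, the multiplication depends on one variable only. Whether (a, y, c)
associates is then independent of y, so every y equals b and the groupoid has a single element,
which is absurd. -/
theorem IsMinimalSH.exists_idemSH {A : Type u} [Mul A] (hA : IsMinimalSH A)
    (hm : HasMinimalClone A) : ∃ a b c : A, IdemSH a b c := by
  obtain ⟨⟨a, b, c⟩, habc⟩ := Set.encard_eq_one.1 hA.1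
  have ne : (a, b, c) ∈ nonassocTriples A := by simp [habc]
  have assoc_or : ∀ x y z : A, x * y * z = x * (y * z) ∨ x = a ∧ y = b ∧ z = c := by
    intro x y z
    by_cases h : (x, y, z) ∈ nonassocTriples A
    · rw [habc] at h
      exact .inr (by simpa using h)
    · exact .inl (not_not.1 h)
  refine ⟨a, b, c, ?_, ne, assoc_or, hA.2 a b c ne⟩
  by_contra hid
  have h := hm.mul_mem (unaryClone A) (n := 1) (.of 0 * .of 0)
    (by
      intro i hi
      apply hid
      intro x
      have := congrFun hi fun _ => x
      exact this)
    ⟨0, fun x => x * x, rfl⟩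
  obtain ⟨i, g, hg⟩ := h
  have hg' : ∀ x y : A, x * y = g ((![x, y] : Fin 2 → A) i) := fun x y => congrFun hg ![x, y]
  have ne' := mem_nonassocTriples.1 ne
  fin_cases i
  · have e : ∀ x y : A, x * y = g x := hg'
    have hb : ∀ y, y = b := fun y => by
      have := assoc_or a y c
      simp only [e] at this ne'
      tauto
    exact ne' ((hb _).trans (hb _).symm)
  · have e : ∀ x y : A, x * y = g y := hg'
    have hb : ∀ y, y = b := fun y => by
      have := assoc_or a y c
      simp only [e] at this ne'
      tauto
    exact ne' ((hb _).trans (hb _).symm)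

namespace IdemSH

variable {A : Type u} [Mul A] {a b c : A}

theorem op (h : IdemSH a b c) :
    IdemSH (MulOpposite.op c) (MulOpposite.op b) (MulOpposite.op a) where
  idem x := MulOpposite.unop_injective (h.idem _)
  ne e := h.ne (MulOpposite.op_injective e).symm
  assoc_or x y z := by
    rcases h.assoc_or z.unop y.unop x.unop with e | ⟨rfl, rfl, rfl⟩
    · exact .inl (MulOpposite.unop_injective e.symm)
    · exact .inr ⟨rfl, rfl, rfl⟩
  gen := by
    rw [eq_top_iff]
    intro x _
    have : x.unop ∈ Subsemigroup.closure ({a, b, c} : Set A) := h.gen ▸ Subsemigroup.mem_top _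
    suffices ∀ y ∈ Subsemigroup.closure ({a, b, c} : Set A), MulOpposite.op y ∈
      Subsemigroup.closure ({MulOpposite.op c, MulOpposite.op b, MulOpposite.op a} : Set Aᵐᵒᵖ) from
      this _ ‹_›
    intro y hy
    induction hy using Subsemigroup.closure_induction with
    | mem y hy =>
      apply Subsemigroup.subset_closure
      rcases hy with rfl | rfl | rfl <;> simp
    | mul y z _ _ hy hz => exact mul_mem hz hy

theorem induction (h : IdemSH a b c) {P : A → Prop} (ha : P a) (hb : P b) (hc : P c)
    (hmul : ∀ x y, P x → P y → P (x * y)) (x : A) : P x := by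
  have : x ∈ Subsemigroup.closure ({a, b, c} : Set A) := h.gen ▸ Subsemigroup.mem_top _
  induction this using Subsemigroup.closure_induction with
  | mem y hy => rcases hy with rfl | rfl | rfl <;> assumption
  | mul y z _ _ hy hz => exact hmul _ _ hy hz

theorem assoc (h : IdemSH a b c) {x y z : A} (hne : x ≠ a ∨ y ≠ b ∨ z ≠ c) :
    x * y * z = x * (y * z) := by
  have := h.assoc_or x y z
  tauto

/-- If a = xy with x, y ≠ a, then (ab)c can be rebracketed to a(bc) using only triples that begin
with x or y, all of them associative. -/
theorem left_irred (h : IdemSH a b c) {x y : A} (e : x * y = a) : x = a ∨ y = a := by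
  by_contra! hxy
  obtain ⟨hx, hy⟩ := hxy
  apply h.ne
  rw [← e, h.assoc (x := x) (.inl hx), h.assoc (x := x) (.inl hx), h.assoc (x := y) (.inl hy),
    h.assoc (x := x) (.inl hx)]

theorem right_irred (h : IdemSH a b c) {x y : A} (e : x * y = c) : x = c ∨ y = c := by
  have := h.op.left_irred (x := MulOpposite.op y) (y := MulOpposite.op x) (by rw [← e]; rfl)
  simpa [or_comm] using this

theorem mid_irred (h : IdemSH a b c) {x y : A} (e : x * y = b) : x = b ∨ y = b := by
  by_contra! hxy
  obtain ⟨hx, hy⟩ := hxy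
  apply h.ne
  rw [← e, ← h.assoc (x := a) (y := x) (.inr (.inl hx)),
    h.assoc (x := a * x) (y := y) (.inr (.inl hy)), h.assoc (x := a) (y := x) (.inr (.inl hx)),
    h.assoc (x := x) (y := y) (.inr (.inl hy))]

/-- If `x` and `y` do not cover the nonassociative triple, then the subgroupoid generated by `x`
and `y` is a semigroup. -/
theorem exists_semigroup (h : IdemSH a b c) {x y : A}
    (hxy : ¬ ((x = a ∨ y = a) ∧ (x = b ∨ y = b) ∧ (x = c ∨ y = c))) :
    ∃ (S : Type u) (_ : Semigroup S) (f : S → A) (s t : S), Function.Injective f ∧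
      (∀ s t, f (s * t) = f s * f t) ∧ f s = x ∧ f t = y := by
  -- An irreducible element lies in the generated subgroupoid only if it is one of the two
  -- generators.
  have key : ∀ {d : A}, (∀ u v : A, u * v = d → u = d ∨ v = d) → ∀ {u : A},
      u ∈ Subsemigroup.closure ({x, y} : Set A) → u = d → x = d ∨ y = d := by
    intro d hd u hu
    induction hu using Subsemigroup.closure_induction with
    | mem u hu => rcases hu with rfl | rfl <;> simp +contextual
    | mul u v _ _ hu hv =>
      intro e
      rcases hd u v e with e | e
      exacts [hu e, hv e]
  let S := Subsemigroup.closure ({x, y} : Set A)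
  refine ⟨S, ⟨fun u v w => Subtype.ext ?_⟩, Subtype.val, ⟨x, Subsemigroup.subset_closure (by simp)⟩,
    ⟨y, Subsemigroup.subset_closure (by simp)⟩, Subtype.val_injective, fun _ _ => rfl, rfl, rfl⟩
  rcases h.assoc_or u v w with e | ⟨e₁, e₂, e₃⟩
  · exact e
  · exact absurd ⟨key (fun _ _ => h.left_irred) u.2 e₁, key (fun _ _ => h.mid_irred) v.2 e₂,
      key (fun _ _ => h.right_irred) w.2 e₃⟩ hxy

end IdemSH
-- Two-generated subgroupoids as bands
namespace IdemSH

section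

variable {A : Type u} {a b c : A}

/-- The elements `x` and `y` do not cover the triple `(a, b, c)`. -/
def Small (a b c x y : A) : Prop := ¬ ((x = a ∨ y = a) ∧ (x = b ∨ y = b) ∧ (x = c ∨ y = c))

theorem Small.symm {x y : A} (h : Small a b c x y) : Small a b c y x := by
  unfold Small at *; tauto

theorem Small.unop {x y : Aᵐᵒᵖ}
    (h : Small (MulOpposite.op c) (MulOpposite.op b) (MulOpposite.op a) x y) :
    Small a b c y.unop x.unop := by
  induction x using MulOpposite.rec' with | h x => ?_
  induction y using MulOpposite.rec' with | h y => ?_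
  simp only [Small, MulOpposite.op_inj, MulOpposite.unop_op] at *
  tauto

end

variable {A : Type u} [Mul A] {a b c : A}

/-- Two elements that do not cover the nonassociative triple generate a band. -/
theorem exists_band (h : IdemSH a b c) {x y : A} (hxy : Small a b c x y) :
    ∃ (S : Type u) (_ : Semigroup S) (f : S → A) (s t : S),
      (∀ s t, f (s * t) = f s * f t) ∧ f s = x ∧ f t = y ∧ (∀ s : S, s * s = s) ∧
      (∀ s r : S, s * (s * r) = s * r) ∧ ∀ s t : S, s * (t * (s * t)) = s * t := by
  obtain ⟨S, _, f, s, t, hf, hmul, hs, ht⟩ := h.exists_semigroup hxy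
  have hid : ∀ s : S, s * s = s := fun s => hf (by rw [hmul, h.idem])
  refine ⟨S, _, f, s, t, hmul, hs, ht, hid, fun s r => by rw [← mul_assoc, hid],
    fun s t => by rw [← mul_assoc, hid]⟩

theorem flex (h : IdemSH a b c) {x y : A} (hxy : Small a b c x y) :
    x * (y * x) = x * y * x := by
  obtain ⟨S, _, f, s, t, hmul, rfl, rfl, -⟩ := h.exists_band hxy
  simp only [← hmul, mul_assoc]

theorem left_idem (h : IdemSH a b c) {x y : A} (hxy : Small a b c x y) :
    x * (x * y) = x * y := by
  obtain ⟨S, _, f, s, t, hmul, rfl, rfl, h₁, h₂, -⟩ := h.exists_band hxy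
  simp only [← hmul, h₂]

theorem right_idem (h : IdemSH a b c) {x y : A} (hxy : Small a b c x y) :
    x * y * y = x * y := by
  obtain ⟨S, _, f, s, t, hmul, rfl, rfl, h₁, h₂, -⟩ := h.exists_band hxy
  simp only [← hmul, mul_assoc, h₁]

theorem not_all_eq (h : IdemSH a b c) : a ≠ b ∨ b ≠ c ∨ a ≠ c := by
  by_contra! H
  obtain ⟨rfl, rfl, -⟩ := H
  exact h.ne (by simp only [h.idem])

/-- Outside the pairs that cover the nonassociative triple, the multiplication satisfies one of
the two-variable laws of left zero bands, right zero bands, left regular bands and right regular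
bands, provided that `(x * y) * x` is nontrivial. -/
theorem left_or_right_regular (h : IdemSH a b c) (hm : HasMinimalClone A)
    (h₁ : ¬ ∀ x y : A, x * y * x = x) (h₂ : ¬ ∀ x y : A, x * y * x = y) :
    (∀ x y, Small a b c x y → x * y = x) ∨ (∀ x y, Small a b c x y → x * y = y) ∨
    (∀ x y, Small a b c x y → x * y = x * y * x) ∨
    (∀ x y, Small a b c x y → x * y = y * x * y) := by
  let P : (A → A → A) → Prop := fun F =>
    (∀ x y, Small a b c x y → F x y = x) ∨ (∀ x y, Small a b c x y → F x y = y) ∨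
      (∀ x y, Small a b c x y → F x y = x * y * x) ∨
      (∀ x y, Small a b c x y → F x y = y * x * y)
  -- In the band generated by x and y, the elements x, y, xyx, yxy are closed under (u, v) ↦ uvu.
  have hP : ∀ F G, P F → P G → P fun x y => F x y * G x y * F x y := by
    rintro F G (hF | hF | hF | hF) (hG | hG | hG | hG)
    all_goals
      first
      | refine .inl fun x y hxy => ?_
        obtain ⟨S, _, f, s, t, hmul, rfl, rfl, e₁, e₂, e₃⟩ := h.exists_band hxy
        simp only [hF _ _ hxy, hG _ _ hxy, ← hmul, mul_assoc, e₁, e₂, e₃]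
        done
      | refine .inr (.inl fun x y hxy => ?_)
        obtain ⟨S, _, f, s, t, hmul, rfl, rfl, e₁, e₂, e₃⟩ := h.exists_band hxy
        simp only [hF _ _ hxy, hG _ _ hxy, ← hmul, mul_assoc, e₁, e₂, e₃]
        done
      | refine .inr (.inr (.inl fun x y hxy => ?_))
        obtain ⟨S, _, f, s, t, hmul, rfl, rfl, e₁, e₂, e₃⟩ := h.exists_band hxy
        simp only [hF _ _ hxy, hG _ _ hxy, ← hmul, mul_assoc, e₁, e₂, e₃]
        done
      | refine .inr (.inr (.inr fun x y hxy => ?_))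
        obtain ⟨S, _, f, s, t, hmul, rfl, rfl, e₁, e₂, e₃⟩ := h.exists_band hxy
        simp only [hF _ _ hxy, hG _ _ hxy, ← hmul, mul_assoc, e₁, e₂, e₃]
  rcases hm.binary (.of 0 * .of 1 * .of 0) (fun x y => x * y * x) (fun _ _ => rfl) P
    (.inl fun _ _ _ => rfl) (.inr (.inl fun _ _ _ => rfl)) hP with H | H | H
  exacts [absurd H h₁, absurd H h₂, H]

/-! ### The nonassociative triple consists of distinct elements -/

/-- The property F(a, b) ≠ ab holds for both projections and is preserved by the term x(xy), because
x(xy) = ab forces x = ab or y = ab. The multiplication violates it. -/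
theorem ne_left_mid_aux (h : IdemSH a a b) (hm : HasMinimalClone A) : False := by
  have hba : b ≠ a := by
    have := h.not_all_eq
    simp at this
    exact fun e => this e.symm
  have hne : a * b ≠ a * (a * b) := by simpa only [h.idem] using h.ne
  have ea : a * b ≠ a := fun e => hne (by rw [e, h.idem])
  have eb : a * b ≠ b := fun e => hne (by rw [e, e])
  have hbe : b * (a * b) = b := by
    by_contra hb
    have e₁ : a * (b * (a * b)) = a * b := by
      rw [← h.assoc (.inr (.inl hba)), h.idem]
    have e₂ := h.assoc (x := a) (y := a) (z := b * (a * b)) (.inr (.inr hb))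
    rw [h.idem, e₁] at e₂
    exact hne e₂
  -- A left factor a or b of x gives ax = x or bx = x (unless x = ab), so x(ab) = ab can be
  -- multiplied by a or b on the left.
  have hdec : ∀ x, ∃ y, x = a * y ∨ x = b * y := by
    intro x
    induction x using h.induction with
    | ha => exact ⟨a, .inl (h.idem a).symm⟩
    | hb => exact ⟨a, .inl (h.idem a).symm⟩
    | hc => exact ⟨b, .inr (h.idem b).symm⟩
    | hmul x z hx _ =>
      obtain ⟨y, rfl | rfl⟩ := hx
      · by_cases hyz : y = a ∧ z = b
        · exact ⟨b, .inl (by rw [hyz.1, hyz.2, h.idem])⟩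
        · exact ⟨y * z, .inl (h.assoc (by tauto))⟩
      · exact ⟨y * z, .inr (h.assoc (.inl hba))⟩
  have hclosed : ∀ x y, x * (x * y) = a * b → x = a * b ∨ y = a * b := by
    intro x y e
    by_contra! hxy
    have hxy' : x ≠ a ∨ y ≠ b := by
      by_contra! H
      rw [H.1, H.2] at e
      exact hne e.symm
    have e' : x * y = a * b := by
      rw [← e, ← h.assoc (by tauto), h.idem]
    rw [e'] at e
    obtain ⟨z, hz | hz⟩ := hdec x
    · have hzb : z ≠ b := fun H => hxy.1 (by rw [hz, H])
      have hax : a * x = x := by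
        rw [hz, ← h.assoc (.inr (.inr hzb)), h.idem]
      apply hne
      conv_rhs => rw [← e, ← h.assoc (.inr (.inr eb)), hax, e]
    · have hbx : b * x = x := by
        rw [hz, ← h.assoc (.inl hba), h.idem]
      apply eb
      have := h.assoc (x := b) (y := x) (z := a * b) (.inl hba)
      rwa [hbx, e, hbe] at this
  rcases hm.binary (.of 0 * (.of 0 * .of 1)) (fun x y => x * (x * y)) (fun _ _ => rfl)
    (fun F => F a b ≠ a * b) ea.symm eb.symm (fun F G hF hG e => by
      rcases hclosed _ _ e with e | e
      exacts [hF e, hG e]) with H | H | H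
  · have e₁ : a * (a * b) * b = a * (a * b) := by
      rw [h.assoc (.inr (.inl ea)), h.assoc (.inr (.inl hba)), h.idem]
    rw [H] at e₁
    exact ea e₁
  · apply hne
    have := H a (a * b)
    rw [← h.assoc (.inr (.inr eb)), h.idem] at this
    exact this.symm
  · exact H rfl

theorem ne_left_mid (h : IdemSH a b c) (hm : HasMinimalClone A) : a ≠ b := by
  rintro rfl
  exact h.ne_left_mid_aux hm

theorem ne_mid_right (h : IdemSH a b c) (hm : HasMinimalClone A) : b ≠ c := by
  rintro rfl
  exact h.op.ne_left_mid_aux hm.op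

end IdemSH
-- Exclusion of a = c
namespace IdemSH

variable {A : Type u} [Mul A] {a b c : A}

/-- If ab is neither a nor b, the law applies to the pair a, ab and gives ab = a(ab) = a; similarly
for ba. So {a, b} is closed under multiplication, and each of the four possibilities makes (ab)a =
a(ba). -/
theorem not_small_left_zero (h : IdemSH a b a) (hab : a ≠ b) :
    ¬ ∀ x y, Small a b a x y → x * y = x := by
  intro H
  have hba := hab.symm
  have e₁ : a * b = a ∨ a * b = b := by
    by_contra! hne
    have := H a (a * b) (by unfold Small; tauto)
    rw [← h.assoc (.inr (.inr hba)), h.idem] at this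
    exact hne.1 this
  have e₂ : b * a = a ∨ b * a = b := by
    by_contra! hne
    have := H b (b * a) (by unfold Small; tauto)
    rw [← h.assoc (.inl hba), h.idem] at this
    exact hne.2 this
  apply h.ne
  rcases e₁ with e₁ | e₁ <;> rcases e₂ with e₂ | e₂ <;> simp only [e₁, e₂, h.idem]

theorem not_small_right_zero (h : IdemSH a b a) (hab : a ≠ b) :
    ¬ ∀ x y, Small a b a x y → x * y = y := by
  intro H
  refine h.op.not_small_left_zero (fun e => hab (MulOpposite.op_injective e)) fun x y hxy => ?_
  exact MulOpposite.unop_injective (H y.unop x.unop hxy.unop)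

theorem flex_ne_right (h : IdemSH a b c) (hac : a = c) (hab : a ≠ b) :
    ¬ ∀ x y : A, x * y * x = y := by
  subst hac
  intro H
  rcases h.left_irred (H b a) with e | e
  · have := H a b
    have e' := H b a
    rw [e] at e'
    rw [e', h.idem] at this
    exact hab this
  · exact hab e.symm

theorem false_of_small_left_regular (h : IdemSH a b a) (hm : HasMinimalClone A) (hab : a ≠ b)
    (h₁ : ¬ ∀ x y : A, x * y * x = x) (h₂ : ¬ ∀ x y : A, x * y * x = y)
    (H : ∀ x y, Small a b a x y → x * y = x * y * x) : False := by
  have hba := hab.symm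
  have hbab : b * (a * b) = b * a * b := (h.assoc (.inl hba)).symm
  have eab : a * b ≠ b := by
    intro e
    have e₁ : b * a ≠ a := fun e' => h.ne (by rw [e, e', h.idem])
    have e₂ : b * a ≠ b := fun e' => h.ne (by rw [e, e', e])
    have := H (b * a) b (by unfold Small; tauto)
    rw [h.assoc (.inl hba), e, h.idem, ← h.assoc (.inl hba), h.idem] at this
    exact e₂ this.symm
  have eaab : a * (a * b) = a * b := by rw [← h.assoc (.inr (.inr hba)), h.idem]
  have ep : a * b * a = a * b := by
    have := H a (a * b) (by unfold Small; tauto)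
    rw [eaab] at this
    exact this.symm
  have eba : b * a ≠ b := fun e => h.ne (by rw [e, ep])
  have hq := h.ne
  rw [ep] at hq
  by_cases e : b * a = a
  · have hd : b * (a * b) = a * b := by rw [hbab, e]
    have hd' : a * b * b = a * b := by rw [h.assoc (.inr (.inr hba)), h.idem]
    -- The values (F(a, b), F(b, a)) stay among (a, b), (b, a), (ab, ab) under (xy)x, whereas the
    -- multiplication has (ab, a).
    rcases hm.binary (.of 0 * .of 1 * .of 0) (fun x y => x * y * x) (fun _ _ => rfl)
      (fun F => (F a b = a ∧ F b a = b) ∨ (F a b = b ∧ F b a = a) ∨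
        (F a b = a * b ∧ F b a = a * b)) (.inl ⟨rfl, rfl⟩) (.inr (.inl ⟨rfl, rfl⟩)) (by
        rintro F G (⟨p, q⟩ | ⟨p, q⟩ | ⟨p, q⟩) (⟨r, s⟩ | ⟨r, s⟩ | ⟨r, s⟩) <;>
          simp [p, q, r, s, h.idem, e, ep, eaab, hd, hd']) with K | K | K
    · exact h₁ K
    · exact h₂ K
    · simp only [e] at K hq
      rw [h.idem] at hq
      rcases K with K | K | K
      exacts [hq K.1, eab K.1, hq K.2.symm]
  · have hbaa : b * a * a = b * a := by rw [h.assoc (.inl hba), h.idem]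
    have hbab' : b * a * b = b * a := by
      have := H b (b * a) (by unfold Small; tauto)
      rw [← h.assoc (.inl hba), h.idem] at this
      exact this.symm
    have ea : a * b = a := by
      by_contra hne
      apply hq
      rw [← hbab', ← hbab, ← h.assoc (.inr (.inr hne)), h.idem]
    obtain ⟨q, hqdef⟩ : ∃ q, q = a * (b * a) := ⟨_, rfl⟩
    rw [ea, ← hqdef] at hq
    have haq : a * q = q := by rw [hqdef, ← h.assoc (.inr (.inl hab)), h.idem]
    have hqa : q * a = q := by rw [hqdef, h.assoc (.inr (.inl eba)), hbaa]
    have hbba : b * (b * a) = b * a := by rw [← h.assoc (.inl hba), h.idem]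
    have hbq : b * q = b * a := by rw [hqdef, ← h.assoc (.inl hba), h.idem]
    have hdq : b * a * q = b * a := by rw [hqdef, ← h.assoc (.inl e), hbaa, h.idem]
    have hqb : q * b = q := by rw [hqdef, h.assoc (.inr (.inl eba)), hbab']
    have hqd : q * (b * a) = q := by rw [hqdef, h.assoc (.inr (.inl eba)), h.idem]
    -- Now ab = a and the groupoid consists of a, b, ba and q = a(ba), with all products known.
    have hall : ∀ x, x = a ∨ x = b ∨ x = b * a ∨ x = q := by
      intro x
      induction x using h.induction with
      | ha => simp
      | hb => simp
      | hc => simp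
      | hmul x y hx hy =>
        rcases hx with rfl | rfl | rfl | rfl <;> rcases hy with rfl | rfl | rfl | rfl <;>
          simp [h.idem, ea, haq, hqa, hbba, hbq, hdq, hqb, hqd, hbaa, hbab', ← hqdef]
    have hclosed : ∀ x y, x * (y * x) = a → x = a ∧ y = a := by
      intro x y
      rcases hall x with rfl | rfl | rfl | rfl <;> rcases hall y with rfl | rfl | rfl | rfl <;>
        simp [h.idem, ea, haq, hqa, hbba, hbq, hdq, hqb, hqd, hbaa, hbab', ← hqdef, hq.symm, hba, e]
    -- Since x(yx) = a only for x = y = a, the term preserves "F(a, b) = a implies that F is the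
    -- first projection". As ab = a, the multiplication would be that projection.
    rcases hm.binary (.of 0 * (.of 1 * .of 0)) (fun x y => x * (y * x)) (fun _ _ => rfl)
      (fun F => F a b = a → ∀ x y, F x y = x) (fun _ _ _ => rfl) (fun e => absurd e hba)
      (by
        intro F G hF hG e x y
        obtain ⟨e₁, e₂⟩ := hclosed _ _ e
        simp only [hF e₁, hG e₂, h.idem]) with K | K | K
    · exact hq ((K a b).symm.trans hqdef.symm)
    · have := K a b
      rw [← hqdef] at this
      rw [this, h.idem] at hbq
      exact eba hbq.symm
    · exact hm.not_proj.1 (K ea)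

theorem ne_left_right (h : IdemSH a b c) (hm : HasMinimalClone A) : a ≠ c := by
  rintro rfl
  have hab := h.ne_left_mid hm
  by_cases h₁ : ∀ x y : A, x * y * x = x
  -- Here (xy)x is trivial, so the other bracketing x(yx) is used; on pairs not covering the triple
  -- the two agree.
  · rcases hm.binary (.of 0 * (.of 1 * .of 0)) (fun x y => x * (y * x)) (fun _ _ => rfl)
      (fun F => (∀ x y, Small a b a x y → F x y = x) ∨ (∀ x y, Small a b a x y → F x y = y))
      (.inl fun _ _ _ => rfl) (.inr fun _ _ _ => rfl)
      (by
        rintro F G (hF | hF) (hG | hG)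
        · exact .inl fun x y hxy => by simp only [hF _ _ hxy, hG _ _ hxy, h.idem]
        · exact .inl fun x y hxy => by simp only [hF _ _ hxy, hG _ _ hxy, h.flex hxy, h₁]
        · exact .inr fun x y hxy => by simp only [hF _ _ hxy, hG _ _ hxy, h.flex hxy.symm, h₁]
        · exact .inr fun x y hxy => by simp only [hF _ _ hxy, hG _ _ hxy, h.idem]) with K | K | K | K
    · exact h.ne (by rw [h₁, K])
    · exact h.op.flex_ne_right rfl (fun e => hab (MulOpposite.op_injective e))
        fun x y => MulOpposite.unop_injective (K x.unop y.unop)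
    · exact h.not_small_left_zero hab K
    · exact h.not_small_right_zero hab K
  · have h₂ := h.flex_ne_right rfl hab
    rcases h.left_or_right_regular hm h₁ h₂ with K | K | K | K
    · exact h.not_small_left_zero hab K
    · exact h.not_small_right_zero hab K
    · exact h.false_of_small_left_regular hm hab h₁ h₂ K
    · refine h.op.false_of_small_left_regular hm.op (fun e => hab (MulOpposite.op_injective e)) ?_
        (h.op.flex_ne_right rfl (fun e => hab (MulOpposite.op_injective e))) ?_
      · intro e
        apply h.not_small_right_zero hab
        intro x y hxy
        rw [K _ _ hxy, ← h.flex hxy.symm]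
        exact MulOpposite.op_injective (e (MulOpposite.op y) (MulOpposite.op x))
      · intro x y hxy
        exact MulOpposite.unop_injective ((K _ _ hxy.unop).trans (h.flex hxy.unop.symm).symm)

end IdemSH
-- Regularity when a, b, c are distinct
namespace IdemSH

variable {A : Type u} [Mul A] {a b c : A}

theorem small_of_minimal (h : IdemSH a b c) (hm : HasMinimalClone A) (x y : A) :
    Small a b c x y := by
  have h₁ := h.ne_left_mid hm
  have h₂ := h.ne_mid_right hm
  have h₃ := h.ne_left_right hm
  rintro ⟨rfl | rfl, rfl | rfl, e⟩ <;> simp_all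

/-- If xyx = x, then ((xy)z)x and x(y(zx)) become x under every identification of two variables,
hence equal x identically. This forces (ab)c = ac = a(bc). -/
theorem not_rectangular (h : IdemSH a b c) (hm : HasMinimalClone A) :
    ¬ ∀ x y : A, x * y * x = x := by
  intro H
  have hs := h.small_of_minimal hm
  have hab := h.ne_left_mid hm
  have hbc := h.ne_mid_right hm
  have H' : ∀ x y : A, x * (y * x) = x := fun x y => by rw [h.flex (hs x y), H]
  have e₁ := hm.semiprojection (.of 0 * .of 1 * .of 2 * .of 0) (fun x y z => x * y * z * x)
    (fun _ _ _ => rfl) (fun x y => by simp only [h.idem, H])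
    (fun x y => by simp only [h.idem, H]) (fun x y => by
      simp only [h.right_idem (hs x y), H]) a b c
  have e₂ := hm.semiprojection (.of 0 * (.of 1 * (.of 2 * .of 0))) (fun x y z => x * (y * (z * x)))
    (fun _ _ _ => rfl) (fun x y => by simp only [h.idem, H'])
    (fun x y => by simp only [h.idem, H']) (fun x y => by
      simp only [h.left_idem (hs y x), H']) c a b
  apply h.ne
  trans a * c
  · -- both sides equal `a * b * c * (a * c)`
    have e₃ : a * b * c * (a * c) = a * c := by
      rw [← h.assoc (.inr (.inl hab)), e₁]
    have e₄ : a * b * c * (a * c) = a * b * c := by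
      rw [h.assoc (.inr (.inl hbc.symm)), H']
    rw [← e₄, e₃]
  · have e₃ : a * c * (a * (b * c)) = a * c := by
      rw [h.assoc (.inr (.inl hbc.symm)), e₂]
    have e₄ : a * c * (a * (b * c)) = a * (b * c) := by
      rw [← h.assoc (.inr (.inl hab)), H]
    rw [← e₄, e₃]

theorem left_or_right_regular_of_minimal (h : IdemSH a b c) (hm : HasMinimalClone A) :
    (∀ x y : A, x * y * x = x * y) ∨ ∀ x y : A, y * x * y = x * y := by
  have hs := h.small_of_minimal hm
  have hne : ¬ ∀ x y : A, x * y * x = y := fun H => hm.not_proj.2 fun x y => by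
    conv_lhs => rw [← H x y, ← h.flex (hs x y), h.left_idem (hs x _), h.flex (hs x y), H]
  rcases h.left_or_right_regular hm (h.not_rectangular hm) hne with K | K | K | K
  · exact absurd (fun x y => K x y (hs x y)) hm.not_proj.1
  · exact absurd (fun x y => K x y (hs x y)) hm.not_proj.2
  · exact .inl fun x y => (K x y (hs x y)).symm
  · exact .inr fun x y => (K x y (hs x y)).symm

end IdemSH

/-! ### The left regular case -/

/-- The only nonassociative triple `(a, b, c)` of `A` consists of distinct elements, it generates
`A`, and the two-generated subgroupoids of `A` are left regular bands. -/
structure LeftRegularSH {A : Type u} [Mul A] (a b c : A) : Prop extends IdemSH a b c where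
  ab : a ≠ b
  bc : b ≠ c
  ac : a ≠ c
  flex' : ∀ x y : A, x * (y * x) = x * y
  regular : ∀ x y : A, x * y * x = x * y
  left_idem' : ∀ x y : A, x * (x * y) = x * y
  right_idem' : ∀ x y : A, x * y * y = x * y

theorem IdemSH.leftRegularSH {A : Type u} [Mul A] {a b c : A} (h : IdemSH a b c)
    (hm : HasMinimalClone A) (hr : ∀ x y : A, x * y * x = x * y) : LeftRegularSH a b c where
  __ := h
  ab := h.ne_left_mid hm
  bc := h.ne_mid_right hm
  ac := h.ne_left_right hm
  flex' x y := (h.flex (h.small_of_minimal hm x y)).trans (hr x y)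
  regular := hr
  left_idem' x y := h.left_idem (h.small_of_minimal hm x y)
  right_idem' x y := h.right_idem (h.small_of_minimal hm x y)

/-- A minimal SH-groupoid with a minimal clone is left regular or dual to a left regular one. -/
theorem exists_leftRegularSH {A : Type u} [Mul A] (hA : IsMinimalSH A) (hm : HasMinimalClone A) :
    (∃ a b c : A, LeftRegularSH a b c) ∨ ∃ a b c : Aᵐᵒᵖ, LeftRegularSH a b c := by
  obtain ⟨a, b, c, h⟩ := hA.exists_idemSH hm
  rcases h.left_or_right_regular_of_minimal hm with K | K
  · exact .inl ⟨a, b, c, h.leftRegularSH hm K⟩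
  · refine .inr ⟨_, _, _, h.op.leftRegularSH hm.op fun x y => MulOpposite.unop_injective ?_⟩
    exact (h.flex (h.small_of_minimal hm _ _)).trans (K _ _)

namespace LeftRegularSH

variable {A : Type u} [Mul A] {a b c : A}

/-- Both (ab)c and a(bc) are fixed by right multiplication by w = a and w = b. If cw ≠ c, then (a,
b, cw) associates, and rebracketing identifies (ab)c with a(bc). -/
theorem c_mul_a_b (h : LeftRegularSH a b c) : c * a = c ∧ c * b = c := by
  have hba := h.ab.symm
  have hcb := h.bc.symm
  have hp : a * b * c * (a * b) = a * b * c := h.regular _ _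
  have hp' : a * b * c * a * b = a * b * c := by rw [h.assoc (.inr (.inl h.ab)), hp]
  have hpa : a * b * c * a = a * b * c := by
    conv_lhs => rw [← hp]
    rw [h.assoc (.inr (.inr h.ac)), h.regular, hp]
  have hpb : a * b * c * b = a * b * c := by rw [hpa] at hp'; exact hp'
  have hqa : a * (b * c) * a = a * (b * c) := h.regular _ _
  have hqb : a * (b * c) * b = a * (b * c) := by
    rw [h.assoc (.inr (.inr h.bc)), h.regular]
  have key : ∀ w, w ≠ c → a * b * c * w = a * b * c → a * (b * c) * w = a * (b * c) →
      c * w = c := by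
    intro w hw e₁ e₂
    by_contra hcw
    apply h.ne
    rw [← e₁, ← e₂, h.assoc (.inr (.inl hcb)), h.assoc (.inr (.inr hcw)),
      h.assoc (.inr (.inr hw)), h.assoc (.inl hba)]
  exact ⟨key a h.ac hpa hqa, key b h.bc hpb hqb⟩

theorem c_mul (h : LeftRegularSH a b c) (x : A) : c * x = c := by
  obtain ⟨ha, hb⟩ := h.c_mul_a_b
  induction x using h.induction with
  | ha => exact ha
  | hb => exact hb
  | hc => exact h.idem c
  | hmul x y hx hy => rw [← h.assoc (.inl h.ac.symm), hx, hy]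

theorem mul_c_mul (h : LeftRegularSH a b c) (x y : A) : x * c * y = x * c := by
  rw [h.assoc (.inr (.inl h.bc.symm)), h.c_mul]

/-- If ab = b, then also ba = b. Whichever of bc, ac differs from c can replace c in the triple; the
new triple associates and yields bc = a(bc). The following lemmas use replacements of the same kind.
-/
theorem ab_ne_b (h : LeftRegularSH a b c) : a * b ≠ b := by
  intro e
  have hba : b * a = b := by
    have := h.regular a b
    rwa [e] at this
  have hbac : b * (a * c) = b * c := by rw [← h.assoc (.inl h.ab.symm), hba]
  have hne := h.ne
  rw [e] at hne
  by_cases hac : a * c = c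
  · have hbc : b * c ≠ c := fun e' => hne (by rw [e', hac])
    have := h.assoc (x := a) (y := b) (z := b * c) (.inr (.inr hbc))
    rw [e, h.left_idem'] at this
    exact hne this
  · have := h.assoc (x := a) (y := b) (z := a * c) (.inr (.inr hac))
    rw [e, hbac] at this
    exact hne this

theorem bc_ne_c_of_ab (h : LeftRegularSH a b c) (e : a * b = a) : b * c ≠ c :=
  fun e' => h.ne (by rw [e, e'])

theorem bc_of_ab_ne_a (h : LeftRegularSH a b c) (e : a * b ≠ a) : b * c = c := by
  by_contra hbc
  apply h.ne
  have := h.assoc (x := a) (y := b) (z := b * c) (.inr (.inr hbc))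
  rwa [← h.assoc (.inl e), h.right_idem', h.left_idem'] at this

theorem ac_of_ba (h : LeftRegularSH a b c) (e : a * b = a) (e' : b * a = b) : a * c = c := by
  by_contra hac
  apply h.ne
  have := h.assoc (x := a) (y := b) (z := a * c) (.inr (.inr hac))
  rw [← h.assoc (x := b) (.inl h.ab.symm), e', e, h.left_idem'] at this
  rw [e, this]

theorem ac_ne_c_of_ba_ne_b (h : LeftRegularSH a b c) (e' : b * a ≠ b) :
    a * c ≠ c := by
  intro hac
  apply h.ne
  have := h.assoc (x := a) (y := b * a) (z := c) (.inr (.inl e'))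
  rwa [h.flex', h.assoc (x := b) (.inl h.ab.symm), hac] at this

theorem ba_eq_a (h : LeftRegularSH a b c) (e : a * b = a) (e' : b * a ≠ b) : b * a = a := by
  by_contra hba
  apply h.ne
  have hbc := h.bc_ne_c_of_ab e
  have hq : a * (b * c) ≠ c := fun H => by
    rcases h.right_irred H with H | H
    exacts [h.ac H, hbc H]
  have e₁ := h.assoc (x := a) (y := b * a) (z := c) (.inr (.inl e'))
  have e₂ := h.assoc (x := b * a) (y := b) (z := c) (.inl hba)
  rw [h.regular] at e₂
  rw [h.flex', e₂, h.assoc (x := b) (.inl h.ab.symm), ← h.assoc (.inr (.inr hq)), e,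
    h.left_idem'] at e₁
  rw [e, e₁]

theorem ba_ne_b (h : LeftRegularSH a b c) (e : a * b ≠ a) : b * a ≠ b := by
  intro hba
  have hbc := h.bc_of_ab_ne_a e
  have hne := h.ne
  rw [hbc] at hne
  by_cases hac : a * c = c
  · rw [hac] at hne
    have := h.assoc (x := a) (y := b) (z := a * b * c) (.inr (.inr hne))
    rw [h.left_idem', ← h.assoc (x := b) (.inl h.ab.symm), h.flex', hba, hbc, hac] at this
    exact hne this
  · have := h.assoc (x := a) (y := b) (z := a * c) (.inr (.inr hac))
    rw [← h.assoc (x := b) (.inl h.ab.symm), hba, hbc, ← h.assoc (.inr (.inl h.ab)),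
      h.regular] at this
    exact hne this

/-- A groupoid that is generated by elements of an injective family that multiplies according to
the table `t` is isomorphic to the groupoid with multiplication table `t`. -/
theorem nonempty_mulEquiv (h : LeftRegularSH a b c) {n : ℕ} (t : Fin n → Fin n → Fin n)
    (v : Fin n → A) (hv : Function.Injective v) (hmul : ∀ i j, v i * v j = v (t i j))
    (ha : ∃ i, v i = a) (hb : ∃ i, v i = b) (hc : ∃ i, v i = c) :
    Nonempty (A ≃* TableGroupoid t) := by
  have hsurj : Function.Surjective v := by
    intro x
    induction x using h.induction with
    | ha => exact ha
    | hb => exact hb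
    | hc => exact hc
    | hmul x y hx hy =>
      obtain ⟨i, rfl⟩ := hx
      obtain ⟨j, rfl⟩ := hy
      exact ⟨_, (hmul i j).symm⟩
  let f : TableGroupoid t ≃* A :=
    ⟨Equiv.ofBijective v ⟨hv, hsurj⟩, fun i j => (hmul i j).symm⟩
  exact ⟨f.symm⟩

end LeftRegularSH

theorem vecCons_injective_iff {A : Type u} {n : ℕ} {x : A} {v : Fin n → A} :
    Function.Injective (Matrix.vecCons x v) ↔ (∀ i, v i ≠ x) ∧ Function.Injective v := by
  rw [Matrix.vecCons, Fin.cons_injective_iff]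
  simp

/-! ### Multiplication tables in the left regular case -/

namespace LeftRegularSH

variable {A : Type u} [Mul A] {a b c : A}

theorem classification_of_ba_eq_b (h : LeftRegularSH a b c) (e : a * b = a) (e' : b * a = b) :
    Nonempty (A ≃* G1) ∨ Nonempty (A ≃* G2) ∨ Nonempty (A ≃* G3) := by
  have hac := h.ac_of_ba e e'
  have hbc := h.bc_ne_c_of_ab e
  have hne := h.ne
  rw [e, hac] at hne
  by_cases hb : b * c = b
  · right; right
    refine h.nonempty_mulEquiv _ ![a, b, c] ?_ ?_ ⟨0, rfl⟩ ⟨1, rfl⟩ ⟨2, rfl⟩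
    · simp [vecCons_injective_iff, Fin.forall_fin_succ, Function.injective_of_subsingleton,
        h.ab.symm, h.bc.symm, h.ac.symm]
    · simp [Fin.forall_fin_succ, tableG3, h.idem, e, e', hac, hb, h.c_mul]
  -- `x` and `y` are the entries e and f of the table of `G1`.
  obtain ⟨x, hx⟩ : ∃ x, x = b * c := ⟨_, rfl⟩
  obtain ⟨y, hy⟩ : ∃ y, y = a * (b * c) := ⟨_, rfl⟩
  have hxmul : ∀ z, x * z = x := fun z => by rw [hx, h.mul_c_mul]
  have hymul : ∀ z, y * z = y := fun z => by
    rw [hy, h.assoc (.inr (.inl hb)), h.mul_c_mul]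
  have hax : a * x = y := by rw [hx, hy]
  have hay : a * y = y := by rw [hy, h.left_idem']
  have hbx : b * x = x := by rw [hx, h.left_idem']
  have hby : b * y = x := by rw [hy, ← h.assoc (.inl h.ab.symm), e', hx, h.left_idem']
  have hxa : x ≠ a := fun H => by
    rcases h.left_irred (hx.symm.trans H) with H | H
    exacts [h.ab H.symm, h.ac H.symm]
  have hya : y ≠ a := fun H => by
    have := hymul c
    rw [H, hac] at this
    exact h.ac this.symm
  have hyb : y ≠ b := fun H => by
    rcases h.mid_irred (hy.symm.trans H) with H | H
    exacts [h.ab H, hb H]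
  rw [← hx] at hb hbc
  rw [← hy] at hne
  by_cases hxy : x = y
  · right; left
    subst hxy
    refine h.nonempty_mulEquiv _ ![a, b, c, x] ?_ ?_ ⟨0, rfl⟩ ⟨1, rfl⟩ ⟨2, rfl⟩
    · simp [vecCons_injective_iff, Fin.forall_fin_succ, Function.injective_of_subsingleton,
        h.ab.symm, h.bc.symm, h.ac.symm, hxa, hb, hbc]
    · simp [Fin.forall_fin_succ, tableG2, h.idem, e, e', hac, h.c_mul, hxmul, hax, hbx, ← hx]
  · left
    refine h.nonempty_mulEquiv _ ![a, b, c, x, y] ?_ ?_ ⟨0, rfl⟩ ⟨1, rfl⟩ ⟨2, rfl⟩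
    · simp [vecCons_injective_iff, Fin.forall_fin_succ, Function.injective_of_subsingleton,
        h.ab.symm, h.bc.symm, h.ac.symm, hxa, hb, hbc,
        hya, hyb, hne.symm, Ne.symm hxy]
    · simp [Fin.forall_fin_succ, tableG1, h.idem, e, e', hac, h.c_mul, hxmul, hymul, hax, hay, hbx,
        hby, ← hx]

theorem classification_of_ba_ne_b (h : LeftRegularSH a b c) (e : a * b = a) (e' : b * a ≠ b) :
    Nonempty (A ≃* G4) ∨ Nonempty (A ≃* G5) := by
  have hac := h.ac_ne_c_of_ba_ne_b e'
  have hba := h.ba_eq_a e e'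
  have hbc := h.bc_ne_c_of_ab e
  have hne := h.ne
  rw [e] at hne
  have hb : b * c ≠ b := fun H => e' (by
    have := h.mul_c_mul b a
    rwa [H] at this)
  -- `x`, `y`, `z` are the entries e, f, g of the table of `G4`.
  obtain ⟨x, hx⟩ : ∃ x, x = b * c := ⟨_, rfl⟩
  obtain ⟨y, hy⟩ : ∃ y, y = a * (b * c) := ⟨_, rfl⟩
  obtain ⟨z, hz⟩ : ∃ z, z = a * c := ⟨_, rfl⟩
  have hxmul : ∀ w, x * w = x := fun w => by rw [hx, h.mul_c_mul]
  have hymul : ∀ w, y * w = y := fun w => by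
    rw [hy, h.assoc (.inr (.inl hb)), h.mul_c_mul]
  have hzmul : ∀ w, z * w = z := fun w => by rw [hz, h.mul_c_mul]
  have hax : a * x = y := by rw [hx, hy]
  have hay : a * y = y := by rw [hy, h.left_idem']
  have haz : a * z = z := by rw [hz, h.left_idem']
  have hbx : b * x = x := by rw [hx, h.left_idem']
  have hby : b * y = y := by rw [hy, ← h.assoc (.inl h.ab.symm), hba]
  have hbz : b * z = z := by rw [hz, ← h.assoc (.inl h.ab.symm), hba]
  have hxa : x ≠ a := fun H => by
    rcases h.left_irred (hx.symm.trans H) with H | H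
    exacts [h.ab H.symm, h.ac H.symm]
  have hyb : y ≠ b := fun H => by
    rcases h.mid_irred (hy.symm.trans H) with H | H
    exacts [h.ab H, hb H]
  have hyc : y ≠ c := fun H => by
    rcases h.right_irred (hy.symm.trans H) with H | H
    exacts [h.ac H, hbc H]
  have hzb : z ≠ b := fun H => by
    rcases h.mid_irred (hz.symm.trans H) with H | H
    exacts [h.ab H, h.bc H.symm]
  rw [← hx] at hb hbc
  rw [← hz] at hac
  rw [← hy, ← hz] at hne
  have hya : y ≠ a := fun H => hne (by rw [hz, ← H, hymul])
  have hza : z ≠ a := fun H => hne (by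
    have := hzmul x
    rw [H, hax] at this
    rw [H, this])
  have hxz : x ≠ z := fun H => hne (by rw [← hax, H, haz])
  by_cases hxy : x = y
  · right
    subst hxy
    refine h.nonempty_mulEquiv _ ![a, b, c, x, z] ?_ ?_ ⟨0, rfl⟩ ⟨1, rfl⟩ ⟨2, rfl⟩
    · simp [vecCons_injective_iff, Fin.forall_fin_succ, Function.injective_of_subsingleton,
        h.ab.symm, h.bc.symm, h.ac.symm, hxa, hb, hbc, hza, hzb, hac, hxz.symm]
    · simp [Fin.forall_fin_succ, tableG5, h.idem, e, hba, h.c_mul, hxmul, hzmul, hax, hbx, haz, hbz,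
        ← hx, ← hz]
  · left
    refine h.nonempty_mulEquiv _ ![a, b, c, x, y, z] ?_ ?_ ⟨0, rfl⟩ ⟨1, rfl⟩ ⟨2, rfl⟩
    · simp [vecCons_injective_iff, Fin.forall_fin_succ, Function.injective_of_subsingleton,
        h.ab.symm, h.bc.symm, h.ac.symm, hxa, hb, hbc, hya, hyb, hyc, hza, hzb, hac, hxz.symm,
        Ne.symm hxy, hne]
    · simp [Fin.forall_fin_succ, tableG4, h.idem, e, hba, h.c_mul, hxmul, hymul, hzmul, hax, hay,
        haz, hbx, hby, hbz, ← hx, ← hz]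

theorem classification_of_ab_ne_a (h : LeftRegularSH a b c) (e : a * b ≠ a) :
    Nonempty (A ≃* G6) ∨ Nonempty (A ≃* G7) ∨ Nonempty (A ≃* G8) ∨ Nonempty (A ≃* G9) ∨
      Nonempty (A ≃* G10) := by
  have e' := h.ab_ne_b
  have hbc := h.bc_of_ab_ne_a e
  have hba := h.ba_ne_b e
  have hba' : b * a ≠ a := fun H => e (by
    have := h.regular b a
    rwa [H] at this)
  have hac := h.ac_ne_c_of_ba_ne_b hba
  have hne := h.ne
  rw [hbc] at hne
  have hab := h.ab
  have hab' := hab.symm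
  have hca := h.ac.symm
  have hcb := h.bc.symm
  obtain ⟨d, hd⟩ : ∃ d, d = a * b := ⟨_, rfl⟩
  obtain ⟨f, hf⟩ : ∃ f, f = a * c := ⟨_, rfl⟩
  -- `k` is the entry h of the table of `G6`; the other letters agree with the table.
  obtain ⟨k, hk⟩ : ∃ k, k = b * a := ⟨_, rfl⟩
  rw [← hd] at e e' hne
  rw [← hf] at hac hne
  rw [← hk] at hba hba'
  obtain ⟨g, hg⟩ : ∃ g, g = d * c := ⟨_, rfl⟩
  obtain ⟨i, hi⟩ : ∃ i, i = k * c := ⟨_, rfl⟩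
  rw [← hg] at hne
  have hfmul : ∀ w, f * w = f := fun w => by rw [hf, h.mul_c_mul]
  have hgmul : ∀ w, g * w = g := fun w => by rw [hg, h.mul_c_mul]
  have himul : ∀ w, i * w = i := fun w => by rw [hi, h.mul_c_mul]
  have had : a * d = d := by rw [hd, h.left_idem']
  have haf : a * f = f := by rw [hf, h.left_idem']
  have hag : a * g = g := by rw [hg, ← h.assoc (.inr (.inl e')), had]
  have hak : a * k = d := by rw [hk, h.flex', hd]
  have hai : a * i = g := by rw [hi, ← h.assoc (.inr (.inl hba)), hak, hg]
  have hbd : b * d = k := by rw [hd, h.flex', hk]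
  have hbf : b * f = i := by rw [hf, ← h.assoc (.inl hab'), ← hk, hi]
  have hbg : b * g = i := by rw [hg, ← h.assoc (.inl hab'), hbd, hi]
  have hbk : b * k = k := by rw [hk, h.left_idem']
  have hbi : b * i = i := by rw [hi, ← h.assoc (.inl hab'), hbk]
  have hda : d * a = d := by rw [hd, h.regular]
  have hdb : d * b = d := by rw [hd, h.right_idem']
  have hdf : d * f = g := by rw [hf, ← h.assoc (.inl e), hda, hg]
  have hdg : d * g = g := by rw [hg, h.left_idem']
  have hdk : d * k = d := by rw [hk, ← h.assoc (.inl e), hdb, hda]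
  have hdi : d * i = g := by rw [hi, ← h.assoc (.inl e), hdk, hg]
  have hka : k * a = k := by rw [hk, h.right_idem']
  have hkb : k * b = k := by rw [hk, h.regular]
  have hkd : k * d = k := by rw [hd, ← h.assoc (.inl hba'), hka, hkb]
  have hkf : k * f = i := by rw [hf, ← h.assoc (.inl hba'), hka, hi]
  have hkg : k * g = i := by rw [hg, ← h.assoc (.inl hba'), hkd, hi]
  have hki : k * i = i := by rw [hi, h.left_idem']
  have hdc : d ≠ c := fun H => by
    rcases h.right_irred (hd.symm.trans H) with H | H
    exacts [h.ac H, h.bc H]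
  have hfa : f ≠ a := fun H => e (by rw [hd, ← H, hfmul])
  have hfb : f ≠ b := fun H => by
    rcases h.mid_irred (hf.symm.trans H) with H | H
    exacts [hab H, hcb H]
  have hga : g ≠ a := fun H => by
    rcases h.left_irred (hg.symm.trans H) with H | H
    exacts [e H, hca H]
  have hgb : g ≠ b := fun H => by
    rcases h.mid_irred (hg.symm.trans H) with H | H
    exacts [e' H, hcb H]
  have hgc : g ≠ c := fun H => by
    rw [H, ← hf] at hag
    exact hac hag
  have hkc : k ≠ c := fun H => by
    rcases h.right_irred (hk.symm.trans H) with H | H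
    exacts [h.bc H, h.ac H]
  have hia : i ≠ a := fun H => by
    rcases h.left_irred (hi.symm.trans H) with H | H
    exacts [hba' H, hca H]
  have hib : i ≠ b := fun H => by
    rcases h.mid_irred (hi.symm.trans H) with H | H
    exacts [hba H, hcb H]
  have hic : i ≠ c := fun H => by
    rw [H, ← hf] at hai
    exact hne hai.symm
  have hfi : f ≠ i := fun H => hne (by rw [← hai, ← H, haf])
  have hfd : f ≠ d := fun H => hne (by rw [hg, ← H, hfmul])
  have hfk : f ≠ k := fun H => hfi (by rw [hi, ← H, hfmul])
  -- The only possible coincidences are among d, g, k, i, and they are linked: d = g exactly when k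
  -- = i, d = k forces g = i, and d = i or g = k forces d = g. Five patterns survive.
  have dg_ki : d = g → k = i := fun H => by rw [← hbd, H, hbg]
  have ki_dg : k = i → d = g := fun H => by rw [← hak, H, hai]
  have dk_gi : d = k → g = i := fun H => by rw [hg, hi, H]
  have di_dg : d = i → d = g := fun H => by rw [hg, H, himul]
  have gk_ki : g = k → k = i := fun H => by rw [hi, ← H, hgmul]
  by_cases hdg' : d = g
  · right; right; right
    obtain rfl := dg_ki hdg'
    subst hdg'
    by_cases hdk' : d = k
    · right
      subst hdk'
      refine h.nonempty_mulEquiv _ ![a, b, c, d, f] ?_ ?_ ⟨0, rfl⟩ ⟨1, rfl⟩ ⟨2, rfl⟩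
      · simp [vecCons_injective_iff, Fin.forall_fin_succ, Function.injective_of_subsingleton,
          hab', hca, hcb, e, e', hdc, hfa, hfb, hac, hfd]
      · simp [Fin.forall_fin_succ, tableG10, h.idem, h.c_mul, hfmul, hgmul, had, haf, hbc, hbd, hbf,
          ← hd, ← hf, ← hk]
    · left
      refine h.nonempty_mulEquiv _ ![a, b, c, d, f, k] ?_ ?_ ⟨0, rfl⟩ ⟨1, rfl⟩ ⟨2, rfl⟩
      · simp [vecCons_injective_iff, Fin.forall_fin_succ, Function.injective_of_subsingleton,
          hab', hca, hcb, e, e', hdc, hfa, hfb, hac, hfd, hba, hba', hkc, Ne.symm hdk', hfk.symm]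
      · simp [Fin.forall_fin_succ, tableG9, h.idem, h.c_mul, hfmul, hgmul, himul, had, haf, hak, hbc,
          hbd, hbf, hbk, ← hd, ← hf, ← hk]
  have hki' : k ≠ i := fun H => hdg' (ki_dg H)
  have hgk' : g ≠ k := fun H => hki' (gk_ki H)
  have hdi' : d ≠ i := fun H => hdg' (di_dg H)
  by_cases hgi : g = i
  · subst hgi
    right
    by_cases hdk' : d = k
    · right; left
      subst hdk'
      refine h.nonempty_mulEquiv _ ![a, b, c, d, f, g] ?_ ?_ ⟨0, rfl⟩ ⟨1, rfl⟩ ⟨2, rfl⟩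
      · simp [vecCons_injective_iff, Fin.forall_fin_succ, Function.injective_of_subsingleton,
          hab', hca, hcb, e, e', hdc, hfa, hfb, hac, hfd, hga, hgb, hgc, hne, Ne.symm hdg']
      · simp [Fin.forall_fin_succ, tableG8, h.idem, h.c_mul, hfmul, hgmul, had, haf, hag, hbc,
          hbd, hbf, hbg, hda, hdb, hdf, hdg, ← hd, ← hf, ← hg, ← hk]
    · left
      refine h.nonempty_mulEquiv _ ![a, b, c, d, f, g, k] ?_ ?_ ⟨0, rfl⟩ ⟨1, rfl⟩ ⟨2, rfl⟩
      · simp [vecCons_injective_iff, Fin.forall_fin_succ, Function.injective_of_subsingleton,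
          hab', hca, hcb, e, e', hdc, hfa, hfb, hac, hfd, hga, hgb, hgc, hne, Ne.symm hdg',
          hba, hba', hkc, Ne.symm hdk', hfk.symm, hgk'.symm]
      · simp [Fin.forall_fin_succ, tableG7, h.idem, h.c_mul, hfmul, hgmul, had, haf, hag, hak, hbc,
          hbd, hbf, hbg, hbk, hda, hdb, hdf, hdg, hdk, hka, hkb, hkd, hkf, hkg,
          ← hd, ← hf, ← hg, ← hk, ← hi]
  · left
    have hdk' : d ≠ k := fun H => hgi (dk_gi H)
    refine h.nonempty_mulEquiv _ ![a, b, c, d, f, g, k, i] ?_ ?_ ⟨0, rfl⟩ ⟨1, rfl⟩ ⟨2, rfl⟩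
    · simp [vecCons_injective_iff, Fin.forall_fin_succ, Function.injective_of_subsingleton,
        hab', hca, hcb, e, e', hdc, hfa, hfb, hac, hfd, hga, hgb, hgc, hne, Ne.symm hdg',
        hba, hba', hkc, hdk'.symm, hfk.symm, hgk'.symm, hia, hib, hic, hdi'.symm, hfi.symm,
        Ne.symm hgi, hki'.symm]
    · simp [Fin.forall_fin_succ, tableG6, h.idem, h.c_mul, hfmul, hgmul, himul, had, haf, hag, hak,
        hai, hbc, hbd, hbf, hbg, hbk, hbi, hda, hdb, hdf, hdg, hdk, hdi, hka, hkb, hkd, hkf, hkg,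
        hki, ← hd, ← hf, ← hg, ← hk, ← hi]

end LeftRegularSH

/-! ### The converse -/

/-- The two-variable laws of left regular bands. -/
structure LeftRegularLaws (A : Type u) [Mul A] : Prop where
  idem : ∀ x : A, x * x = x
  left_idem : ∀ x y : A, x * (x * y) = x * y
  flex : ∀ x y : A, x * (y * x) = x * y
  regular : ∀ x y : A, x * y * x = x * y
  right_idem : ∀ x y : A, x * y * y = x * y
  mul_swap : ∀ x y : A, x * y * (y * x) = x * y

/-- The leftmost variable of a term. -/
def leftmost {n : ℕ} (t : FreeMagma (Fin n)) : Fin n :=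
  match t with
  | .of i => i
  | .mul p _ => leftmost p

/-- Every term operation of a groupoid with the two-variable laws of left regular bands is a
projection, or identification of variables turns it into the multiplication. -/
theorem LeftRegularLaws.proj_or_mul {A : Type u} [Mul A] (h : LeftRegularLaws A) {n : ℕ}
    (t : FreeMagma (Fin n)) :
    (∀ x : Fin n → A, termFun A t x = x (leftmost t)) ∨
      ∀ x y : A, termFun A t (fun j => if j = leftmost t then x else y) = x * y := by
  have hmul : ∀ (p q : FreeMagma (Fin n)) (x : Fin n → A),
      termFun A (p * q) x = termFun A p x * termFun A q x := fun p q x => by simp [termFun]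
  -- Modulo these laws, two variables yield only x, xy, y, yx, and the leftmost variable decides
  -- between the first two and the last two.
  have key : ∀ (s : FreeMagma (Fin n)) (i : Fin n) (x y : A),
      let r := termFun A s fun j => if j = i then x else y
      leftmost s = i ∧ (r = x ∨ r = x * y) ∨ leftmost s ≠ i ∧ (r = y ∨ r = y * x) := by
    intro s i x y
    induction s with
    | ih1 j =>
      by_cases hj : j = i
      · exact .inl ⟨hj, .inl (by simp [termFun, hj])⟩
      · exact .inr ⟨hj, .inl (by simp [termFun, hj])⟩
    | ih2 p q hp hq =>
      have hl : leftmost (p * q) = leftmost p := rfl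
      simp only [hmul, hl]
      rcases hp with ⟨h₁, hp | hp⟩ | ⟨h₁, hp | hp⟩ <;>
        rcases hq with ⟨-, hq | hq⟩ | ⟨-, hq | hq⟩ <;>
        simp [h₁, hp, hq, h.idem, h.left_idem, h.flex, h.regular, h.right_idem, h.mul_swap]
  induction t with
  | ih1 i => exact .inl fun x => rfl
  | ih2 p q hp hq =>
    have hl : leftmost (p * q) = leftmost p := rfl
    rw [hl]
    rcases hp with hp | hp
    · by_cases e : leftmost q = leftmost p
      · rcases hq with hq | hq
        · exact .inl fun x => by rw [hmul, hp, hq, e, h.idem]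
        · exact .inr fun x y => by rw [hmul, ← e, hq, e, hp]; simp [h.left_idem]
      · right
        intro x y
        rw [hmul, hp]
        rcases key q (leftmost p) x y with ⟨e', -⟩ | ⟨-, e' | e'⟩
        · exact absurd e' e
        · simp [e']
        · simp [e', h.flex]
    · right
      intro x y
      rw [hmul, hp]
      rcases key q (leftmost p) x y with ⟨-, e | e⟩ | ⟨-, e | e⟩ <;>
        simp [e, h.idem, h.regular, h.right_idem, h.mul_swap]

/-- A subclone without the multiplication contains only projections: any other term operation gives
xy after substituting the two binary projections for its variables. -/
theorem LeftRegularLaws.hasMinimalClone {A : Type u} [Mul A] (h : LeftRegularLaws A)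
    (h₁ : ¬ ∀ x y : A, x * y = x) (h₂ : ¬ ∀ x y : A, x * y = y) : HasMinimalClone A := by
  refine ⟨fun hbot => ?_, fun C hC => ?_⟩
  · have := mul_mem_clo A
    rw [hbot] at this
    obtain ⟨i, hi⟩ := this
    have hi' : ∀ x y : A, x * y = (![x, y] : Fin 2 → A) i := fun x y => congrFun hi ![x, y]
    fin_cases i
    exacts [h₁ hi', h₂ hi']
  · by_contra hne
    apply hC.not_ge
    have hmul : (fun x : Fin 2 → A => x 0 * x 1) ∈ C.ops 2 := by
      by_contra hm
      apply hne
      refine le_antisymm (fun n f hf => ?_) bot_le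
      obtain ⟨t, rfl⟩ := hC.le n hf
      rcases h.proj_or_mul t with ht | ht
      · exact ⟨_, funext ht⟩
      · refine absurd ?_ hm
        have := C.comp_mem n 2 _ (fun j x => if j = leftmost t then x 0 else x 1) hf (fun j => by
          split_ifs
          exacts [C.proj_mem 2 0, C.proj_mem 2 1])
        simpa only [ht] using this
    rintro n f ⟨t, rfl⟩
    induction t with
    | ih1 i => exact C.proj_mem n i
    | ih2 p q hp hq =>
      have := C.comp_mem 2 n _ ![termFun A p, termFun A q] hmul (by
        intro i
        fin_cases i
        exacts [hp, hq])
      have e : termFun A (p * q) = fun x => termFun A p x * termFun A q x := by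
        funext x; simp [termFun]
      rw [e]
      exact this

/-! ### Finite criteria for multiplication tables -/

theorem isMinimalSH_of_forall {A : Type u} [Mul A] (a b c : A)
    (h : ∀ x y z : A, x * y * z ≠ x * (y * z) ↔ x = a ∧ y = b ∧ z = c)
    (hgen : ∀ x : A, x ∈ [a, b, c] ∨ ∃ y ∈ [a, b, c], ∃ z ∈ [a, b, c], x = y * z ∨
      ∃ w ∈ [a, b, c], x = y * z * w ∨ x = y * (z * w)) :
    IsMinimalSH A := by
  have hset : nonassocTriples A = {(a, b, c)} := by
    ext ⟨x, y, z⟩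
    exact (h x y z).trans (by simp)
  refine ⟨by rw [IsSH, hset, Set.encard_singleton], fun a' b' c' h' => ?_⟩
  obtain ⟨rfl, rfl, rfl⟩ := (h a' b' c').1 h'
  rw [eq_top_iff]
  intro x _
  let S : Subsemigroup A := Subsemigroup.closure {a', b', c'}
  have hsub : ∀ y ∈ [a', b', c'], y ∈ S := fun y hy =>
    Subsemigroup.subset_closure (by simpa using hy)
  rcases hgen x with hx | ⟨y, hy, z, hz, rfl | ⟨w, hw, rfl | rfl⟩⟩
  · exact hsub _ hx
  · exact mul_mem (hsub _ hy) (hsub _ hz)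
  · exact mul_mem (mul_mem (hsub _ hy) (hsub _ hz)) (hsub _ hw)
  · exact mul_mem (hsub _ hy) (mul_mem (hsub _ hz) (hsub _ hw))

/-- The hypotheses are decidable statements over `Fin n`; products of at most three generators
exhaust each of the ten tables. -/
theorem isMinimalSH_of_table {n : ℕ} (t : Fin n → Fin n → Fin n) (a b c : Fin n)
    (h : ∀ x y z, t (t x y) z ≠ t x (t y z) ↔ x = a ∧ y = b ∧ z = c)
    (hgen : ∀ x, x ∈ [a, b, c] ∨ ∃ y ∈ [a, b, c], ∃ z ∈ [a, b, c], x = t y z ∨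
      ∃ w ∈ [a, b, c], x = t (t y z) w ∨ x = t y (t z w)) :
    IsMinimalSH (TableGroupoid t) :=
  isMinimalSH_of_forall (A := TableGroupoid t) a b c h hgen

theorem hasMinimalClone_of_table {n : ℕ} (t : Fin n → Fin n → Fin n)
    (h : ∀ x y, t x x = x ∧ t x (t x y) = t x y ∧ t x (t y x) = t x y ∧ t (t x y) x = t x y ∧
      t (t x y) y = t x y ∧ t (t x y) (t y x) = t x y)
    (h₁ : ∃ x y, t x y ≠ x) (h₂ : ∃ x y, t x y ≠ y) : HasMinimalClone (TableGroupoid t) := by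
  refine LeftRegularLaws.hasMinimalClone ⟨fun x => (h x x).1, fun x y => (h x y).2.1,
    fun x y => (h x y).2.2.1, fun x y => (h x y).2.2.2.1, fun x y => (h x y).2.2.2.2.1,
    fun x y => (h x y).2.2.2.2.2⟩ (fun H => ?_) (fun H => ?_)
  · obtain ⟨x, y, hxy⟩ := h₁
    exact hxy (H x y)
  · obtain ⟨x, y, hxy⟩ := h₂
    exact hxy (H x y)

theorem isFactorOf_of_table {m n : ℕ} (s : Fin m → Fin m → Fin m) (t : Fin n → Fin n → Fin n)
    (f : Fin m → Fin n) (hf : ∀ x y, f (s x y) = t (f x) (f y)) (hsurj : ∀ y, ∃ x, f x = y) :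
    IsFactorOf (TableGroupoid t) (TableGroupoid s) := by
  let g : TableGroupoid s →ₙ* TableGroupoid t := ⟨f, hf⟩
  let r : Con (TableGroupoid s) :=
    { Setoid.ker g with
      mul' := fun {w x y z} h₁ h₂ => by
        change g (w * y) = g (x * z)
        rw [map_mul, map_mul, show g w = g x from h₁, show g y = g z from h₂] }
  refine ⟨r, ⟨(Equiv.ofBijective (fun x => Con.liftOn x g fun _ _ h => h)
    ⟨fun x y => ?_, fun y => ?_⟩ : r.Quotient ≃ TableGroupoid t), fun x y => ?_⟩⟩
  · induction x using Con.induction_on with | H x => ?_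
    induction y using Con.induction_on with | H y => ?_
    exact fun h => (Con.eq r).2 h
  · obtain ⟨x, hx⟩ := hsurj y
    exact ⟨Con.toQuotient (c := r) x, hx⟩
  · induction x using Con.induction_on with | H x => ?_
    induction y using Con.induction_on with | H y => ?_
    exact map_mul g x y

theorem LeftRegularSH.classification {A : Type u} [Mul A] {a b c : A} (h : LeftRegularSH a b c) :
    Nonempty (A ≃* G1) ∨ Nonempty (A ≃* G2) ∨ Nonempty (A ≃* G3) ∨ Nonempty (A ≃* G4) ∨
      Nonempty (A ≃* G5) ∨ Nonempty (A ≃* G6) ∨ Nonempty (A ≃* G7) ∨ Nonempty (A ≃* G8) ∨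
      Nonempty (A ≃* G9) ∨ Nonempty (A ≃* G10) := by
  by_cases e : a * b = a
  · by_cases e' : b * a = b
    · have := h.classification_of_ba_eq_b e e'
      tauto
    · have := h.classification_of_ba_ne_b e e'
      tauto
  · have := h.classification_of_ab_ne_a e
    tauto

end SzaszHajek

/-- A complete list of the minimal SH-groupoids with a minimal clone, up to isomorphism and
dual isomorphism. -/
theorem theorem3p4 :
    -- every minimal SH-groupoid with a minimal clone is in the list
    (∀ (A : Type*) [Mul A], IsMinimalSH A → HasMinimalClone A →
      IsoOrDuallyIso A G1 ∨ IsoOrDuallyIso A G2 ∨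
      IsoOrDuallyIso A G3 ∨ IsoOrDuallyIso A G4 ∨
      IsoOrDuallyIso A G5 ∨ IsoOrDuallyIso A G6 ∨
      IsoOrDuallyIso A G7 ∨ IsoOrDuallyIso A G8 ∨
      IsoOrDuallyIso A G9 ∨ IsoOrDuallyIso A G10) ∧
    -- every member of the list is a minimal SH-groupoid with a minimal clone
    ((IsMinimalSH G1 ∧ HasMinimalClone G1) ∧
      (IsMinimalSH G2 ∧ HasMinimalClone G2) ∧
      (IsMinimalSH G3 ∧ HasMinimalClone G3) ∧
      (IsMinimalSH G4 ∧ HasMinimalClone G4) ∧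
      (IsMinimalSH G5 ∧ HasMinimalClone G5) ∧
      (IsMinimalSH G6 ∧ HasMinimalClone G6) ∧
      (IsMinimalSH G7 ∧ HasMinimalClone G7) ∧
      (IsMinimalSH G8 ∧ HasMinimalClone G8) ∧
      (IsMinimalSH G9 ∧ HasMinimalClone G9) ∧
      (IsMinimalSH G10 ∧ HasMinimalClone G10)) ∧
    -- the factors of `G1`, `G4` and `G6` in the list
    (IsFactorOf G2 G1 ∧
      IsFactorOf G5 G4 ∧
      IsFactorOf G7 G6 ∧
      IsFactorOf G8 G6 ∧
      IsFactorOf G9 G6 ∧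
      IsFactorOf G10 G6) := by
  refine ⟨fun A _ hA hm => ?_, ?_, ?_⟩
  · have dual : ∀ (B : Type) [Mul B], Nonempty (Aᵐᵒᵖ ≃* B) → IsoOrDuallyIso A B :=
      fun B _ ⟨e⟩ => .inr ⟨(MulEquiv.opOp A).trans (MulEquiv.op e)⟩
    rcases exists_leftRegularSH hA hm with ⟨a, b, c, h⟩ | ⟨a, b, c, h⟩
    · have := h.classification
      unfold IsoOrDuallyIso
      tauto
    · rcases h.classification with H | H | H | H | H | H | H | H | H | H <;>
        simp [dual _ H]
  · refine ⟨⟨isMinimalSH_of_table _ 0 1 2 ?_ ?_, hasMinimalClone_of_table _ ?_ ?_ ?_⟩,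
      ⟨isMinimalSH_of_table _ 0 1 2 ?_ ?_, hasMinimalClone_of_table _ ?_ ?_ ?_⟩,
      ⟨isMinimalSH_of_table _ 0 1 2 ?_ ?_, hasMinimalClone_of_table _ ?_ ?_ ?_⟩,
      ⟨isMinimalSH_of_table _ 0 1 2 ?_ ?_, hasMinimalClone_of_table _ ?_ ?_ ?_⟩,
      ⟨isMinimalSH_of_table _ 0 1 2 ?_ ?_, hasMinimalClone_of_table _ ?_ ?_ ?_⟩,
      ⟨isMinimalSH_of_table _ 0 1 2 ?_ ?_, hasMinimalClone_of_table _ ?_ ?_ ?_⟩,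
      ⟨isMinimalSH_of_table _ 0 1 2 ?_ ?_, hasMinimalClone_of_table _ ?_ ?_ ?_⟩,
      ⟨isMinimalSH_of_table _ 0 1 2 ?_ ?_, hasMinimalClone_of_table _ ?_ ?_ ?_⟩,
      ⟨isMinimalSH_of_table _ 0 1 2 ?_ ?_, hasMinimalClone_of_table _ ?_ ?_ ?_⟩,
      ⟨isMinimalSH_of_table _ 0 1 2 ?_ ?_, hasMinimalClone_of_table _ ?_ ?_ ?_⟩⟩
    all_goals decide +kernel
  -- The maps merge, in this order: e, f in `G1`; e, f in `G4`; then in `G6` the classes {g, i}; {d,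
  -- h} and {g, i}; {d, g} and {h, i}; {d, g, h, i}.
  · refine ⟨isFactorOf_of_table _ _ ![0, 1, 2, 3, 3] ?_ ?_,
      isFactorOf_of_table _ _ ![0, 1, 2, 3, 3, 4] ?_ ?_,
      isFactorOf_of_table _ _ ![0, 1, 2, 3, 4, 5, 6, 5] ?_ ?_,
      isFactorOf_of_table _ _ ![0, 1, 2, 3, 4, 5, 3, 5] ?_ ?_,
      isFactorOf_of_table _ _ ![0, 1, 2, 3, 4, 3, 5, 5] ?_ ?_,
      isFactorOf_of_table _ _ ![0, 1, 2, 3, 4, 3, 3, 3] ?_ ?_⟩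
    all_goals decide +kernel
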